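/- Let $x$ be a real number with $|x|<1$. An index is a finite (possibly empty) sequence $\mathbf{k}=(k_1,\dots,k_r)$ of positive integers; $1^m$ denotes the index $(1,\dots,1)$ with $m$ entries. Put $$\zeta_N^{(x)}(\mathbf{k})=\sum_{0<m_1<\cdots<m_r<N}\frac{1}{(m_1+x)^{k_1}\cdots(m_r+x)^{k_r}}\quad(N\in\mathbb{Z}_{>0}),$$ $$\mathrm{Li}_{\mathbf{k}}^{(x)}(t)=\sum_{0<m_1<\cdots<m_r}\frac{t^{m_r+x}}{(m_1+x)^{k_1}\cdots(m_r+x)^{k_r}}\quad(0<t<1),$$ both equal to $1$ for $\mathbf{k}=\varnothing$, and, if $k_r>1$, $\zeta^{(x)}(\mathbf{k})=\sum_{0<m_1<\cdots<m_r}(m_1+x)^{-k_1}\cdots(m_r+x)^{-k_r}$; extend $\zeta^{(x)}$ linearly to formal sums of such indices. Let $\psi=\Gamma'/\Gamma$. For every index $\mathbf{k}$ there are unique polynomials $Z_*^{(x)}(\mathbf{k};T)$ and $P^{(x)}(\mathbf{k};T)$ in $\mathbb{R}[T]$ such that, for some $p>0$, $$\zeta_N^{(x)}(\mathbf{k})=Z_*^{(x)}(\mathbf{k};\log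 N-\psi(1+x))+O(N^{-1}\log^pN)\quad(N\to\infty)$$ and, for some $p>0$, $$\mathrm{Li}_{\mathbf{k}}^{(x)}(t)=P^{(x)}(\mathbf{k};-\log(1-t))+O((1-t)\log^p(1-t))\quad(t\to1^-).$$ For non-empty indices $\mathbf{k}=(k_1,\dots,k_r)$ and $\mathbf{l}=(l_1,\dots,l_s)$ put $\mathbf{k}_+=(k_1,\dots,k_{r-1},k_r+1)$ and $\mathbf{k}\circledast\mathbf{l}=((k_1,\dots,k_{r-1})*(l_1,\dots,l_{s-1}),\,k_r+l_s)$. Here $*$ is the stuffle product, the bilinear product on formal sums of indices with $\varnothing*\mathbf{k}=\mathbf{k}*\varnothing=\mathbf{k}$ and $(a,\mathbf{k})*(b,\mathbf{l})=(a,\mathbf{k}*(b,\mathbf{l}))+(b,(a,\mathbf{k})*\mathbf{l})+(a+b,\mathbf{k}*\mathbf{l})$. Let $\mathbf{l}^\star$ be the formal sum of the $2^{s-1}$ indices obtained from $(l_1\,\square\,\cdots\,\square\,l_s)$ by replacing each $\square$ by a comma or a plus sign, and extend $\circledast$ bilinearly. The functions $$y\mapsto\frac{\Gamma(1+x)e^{\psi(1+x)y}}{\Gamma(1+x+y)}\qquad\text{and}\qquad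 y\mapsto\frac{\Gamma(1+x)\Gamma(1+y)}{\Gamma(1+x+y)}$$ are real analytic at $y=0$, and, when they are identified with their Taylor series at $y=0$, the following identities hold in the formal power series ring $\mathbb{R}[T][[y]]$. 1) One has $$\sum_{m=0}^\infty Z_*^{(x)}(1^m;T)\,y^m=\frac{\Gamma(1+x)e^{\psi(1+x)y}}{\Gamma(1+x+y)}\,e^{Ty},$$ and for every non-empty index $\mathbf{k}$ $$\sum_{m=0}^\infty Z_*^{(x)}(\mathbf{k}_+,1^m;T)\,y^m=\left(\sum_{m=0}^\infty(-1)^m\zeta^{(x)}\bigl(\mathbf{k}\circledast(1^{m+1})^\star\bigr)y^m\right)\frac{\Gamma(1+x)e^{\psi(1+x)y}}{\Gamma(1+x+y)}\,e^{Ty}.$$ 2) One has $$\sum_{m=0}^\infty P^{(x)}(1^m;T)\,y^m=\frac{\Gamma(1+x)\Gamma(1+y)}{\Gamma(1+x+y)}\,e^{Ty},$$ and for every non-empty index $\mathbf{k}$ $$\sum_{m=0}^\infty P^{(x)}(\mathbf{k}_+,1^m;T)\,y^m=\left(\sum_{m=0}^\infty(-1)^m\zeta^{(x)}\bigl(\mathbf{k}\circledast(1^{m+1})^\star\bigr)y^m\right)\frac{\Gamma(1+x)\Gamma(1+y)}{\Gamma(1+x+y)}\,e^{Ty}.$$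 -/

import Mathlib

namespace HurwitzMZV

/-- An index `(k₁, …, k_r)` of positive integers; the empty list is the empty index. -/
abbrev Index := List ℕ+

/-- The index `(1, …, 1)` with `m` entries. -/
def ones (m : ℕ) : Index := List.replicate m 1

/-- `k₊ = (k₁, …, k_{r-1}, k_r + 1)` for a non-empty index `k` (and `∅₊ = ∅`, which is never used). -/
def plus (k : Index) : Index :=
  match k.getLast? with
  | some a => k.dropLast ++ [a + 1]
  | none => []

/-- The stuffle (harmonic) product of two indices. A formal sum of indices with non-negative integer
coefficients is represented by a multiset of indices. -/
def stuffle : Index → Index → Multiset Index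
  | [], l => {l}
  | a :: k, [] => {a :: k}
  | a :: k, b :: l =>
      (stuffle k (b :: l)).map (fun w => a :: w) + (stuffle (a :: k) l).map (fun w => b :: w)
        + (stuffle k l).map (fun w => (a + b) :: w)
termination_by k l => k.length + l.length

/-- `k ⊛ l = ((k₁, …, k_{r-1}) * (l₁, …, l_{s-1}), k_r + l_s)` for non-empty indices `k`, `l`
(and `0` if one of them is empty, which is never used). -/
def circledast (k l : Index) : Multiset Index :=
  match k.getLast?, l.getLast? with
  | some a, some b => (stuffle k.dropLast l.dropLast).map (fun w => w ++ [a + b])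
  | _, _ => 0

/-- `l^⋆`: the formal sum of the `2 ^ (s - 1)` indices `(l₁ □ ⋯ □ l_s)`, where each `□` is either a
comma or a plus sign. -/
def starSum : Index → Multiset Index
  | [] => {[]}
  | [a] => {[a]}
  | a :: b :: l => (starSum (b :: l)).map (fun w => a :: w) + starSum ((a + b) :: l)
termination_by l => l.length

/-- `k ⊛ l^⋆`, where `⊛` is extended linearly to formal sums. -/
def circledastStar (k l : Index) : Multiset Index :=
  (starSum l).bind (fun w => circledast k w)

/-- `1 / ((m₁ + x) ^ k₁ ⋯ (m_r + x) ^ k_r)`. -/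
noncomputable def term (x : ℝ) (k : Index) (m : Fin k.length → ℕ) : ℝ :=
  1 / ∏ i, ((m i : ℝ) + x) ^ (k.get i : ℕ)

/-- Tuples of integers with `0 < m₁ < ⋯ < m_r`. -/
abbrev Chain (r : ℕ) := {m : Fin r → ℕ // StrictMono m ∧ ∀ i, 0 < m i}

open Classical in
/-- The truncated sum `ζ_N^{(x)}(k)`, over `0 < m₁ < ⋯ < m_r < N`. -/
noncomputable def zetaTrunc (x : ℝ) (k : Index) (N : ℕ) : ℝ :=
  ∑ m ∈ (Fintype.piFinset fun _ : Fin k.length => Finset.Ioo 0 N).filter StrictMono, term x k m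

/-- The Hurwitz type multiple zeta value `ζ^{(x)}(k)`, over `0 < m₁ < ⋯ < m_r`. -/
noncomputable def zeta (x : ℝ) (k : Index) : ℝ :=
  ∑' m : Chain k.length, term x k m.1

/-- The linear extension of `ζ^{(x)}` to formal sums of indices. -/
noncomputable def zetaSum (x : ℝ) (s : Multiset Index) : ℝ :=
  (s.map (zeta x)).sum

open Classical in
/-- `Li_k^{(x)}(t) = ∑_{0 < m₁ < ⋯ < m_r} t ^ (m_r + x) / ((m₁ + x) ^ k₁ ⋯ (m_r + x) ^ k_r)`, and
`Li_∅^{(x)}(t) = 1`. -/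
noncomputable def Li (x : ℝ) (k : Index) (t : ℝ) : ℝ :=
  if h : k = [] then 1
  else ∑' m : Chain k.length,
    t ^ ((m.1 ⟨k.length - 1, Nat.sub_one_lt (mt List.length_eq_zero_iff.mp h)⟩ : ℝ) + x)
      * term x k m.1

/-- The real digamma function `ψ = Γ' / Γ`. -/
noncomputable def psi (s : ℝ) : ℝ := deriv Real.Gamma s / Real.Gamma s

/-- `Q` satisfies `ζ_N^{(x)}(k) = Q(log N - ψ(1 + x)) + O(N⁻¹ log ^ p N)` as `N → ∞`,
for some `p > 0`. -/
def IsSeriesReg (x : ℝ) (k : Index) (Q : Polynomial ℝ) : Prop :=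
  ∃ p : ℕ, 0 < p ∧
    (fun N : ℕ => zetaTrunc x k N - Q.eval (Real.log N - psi (1 + x)))
      =O[Filter.atTop] fun N : ℕ => (N : ℝ)⁻¹ * Real.log N ^ p

/-- `Q` satisfies `Li_k^{(x)}(t) = Q(-log (1 - t)) + O((1 - t) log ^ p (1 - t))` as `t → 1` from
below, for some `p > 0`. -/
def IsIntegralReg (x : ℝ) (k : Index) (Q : Polynomial ℝ) : Prop :=
  ∃ p : ℕ, 0 < p ∧
    (fun t : ℝ => Li x k t - Q.eval (-Real.log (1 - t)))
      =O[nhdsWithin 1 (Set.Iio 1)] fun t : ℝ => (1 - t) * Real.log (1 - t) ^ p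

/-- The series regularization `Z_*^{(x)}(k; T)`: the polynomial with the property `IsSeriesReg`. -/
noncomputable def seriesReg (x : ℝ) (k : Index) : Polynomial ℝ :=
  Classical.epsilon (IsSeriesReg x k)

/-- The integral regularization `P^{(x)}(k; T)`: the polynomial with the property `IsIntegralReg`. -/
noncomputable def integralReg (x : ℝ) (k : Index) : Polynomial ℝ :=
  Classical.epsilon (IsIntegralReg x k)

/-- The factor `Γ(1 + x) e ^ (ψ(1 + x) y) / Γ(1 + x + y)`. -/
noncomputable def seriesFactor (x y : ℝ) : ℝ :=
  Real.Gamma (1 + x) * Real.exp (psi (1 + x) * y) / Real.Gamma (1 + x + y)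

/-- The factor `Γ(1 + x) Γ(1 + y) / Γ(1 + x + y)`. -/
noncomputable def integralFactor (x y : ℝ) : ℝ :=
  Real.Gamma (1 + x) * Real.Gamma (1 + y) / Real.Gamma (1 + x + y)

/-- The Taylor series at `0` of a function, as a formal power series. -/
noncomputable def taylor (f : ℝ → ℝ) : PowerSeries ℝ :=
  PowerSeries.mk fun n => iteratedDeriv n f 0 / (n.factorial : ℝ)

/-- The inclusion of `ℝ[[y]]` into `ℝ[T][[y]]`. -/
noncomputable def incl : PowerSeries ℝ →+* PowerSeries (Polynomial ℝ) :=
  PowerSeries.map Polynomial.C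

/-- The formal power series `e ^ (T y) = ∑ T ^ n y ^ n / n!` in `ℝ[T][[y]]`. -/
noncomputable def expT : PowerSeries (Polynomial ℝ) :=
  PowerSeries.mk fun n => Polynomial.C (1 / (n.factorial : ℝ)) * Polynomial.X ^ n

/-- The formal power series `∑_m (-1) ^ m ζ^{(x)}(k ⊛ (1, …, 1)^⋆) y ^ m`, with `m + 1` ones. -/
noncomputable def starSeries (x : ℝ) (k : Index) : PowerSeries ℝ :=
  PowerSeries.mk fun m => (-1) ^ m * zetaSum x (circledastStar k (ones (m + 1)))

end HurwitzMZV

/-! ### Nested sums and the stuffle product -/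

namespace HurwitzMZV

open Finset

/-! Everything is read off generating series in `y` of truncated sums. For fixed `N`, the series of
`ζ_N(1^m)` is the product of `1 + y/(n+x)` over `0 < n < N` (`mk_ones`), and the series of `ζ_N(k₊,
1^m)` is exactly this product times the truncated star series of `k` (`mk_plus_ones`). The star sums
of ones ending at `n` are complete symmetric functions, whose signed generating series inverts the
product over `i ≤ n`; hence both sides satisfy the same first-order recurrence in `N`.

By Gauss's limit formula, `N^(-y)` times the product tends to `Γ(1+x)/Γ(1+x+y)` at rate `1/N`,
uniformly on a small complex disc, and Cauchy's estimate passes this to Taylor coefficients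
(`small_coeff_onesSeries_sub`). The star series only involves convergent values, approached with
error `O(log^p N / N)` (`small_zetaTrunc_sub`). Recentring `log N` at `ψ(1+x)` gives the identities
for `Z_*`.

For the integral regularization, `Li_k(t)` with `k` non-empty is `t^x` times the Abel mean `(1-t) ∑
ζ_N(k) t^(N-1)` (`Li_eq_abelMean`). Powers of `log N` have no simple Abel mean, but the elementary
symmetric functions of `1, 1/2, …, 1/(N-1)` do: degree `i` yields `(-log(1-t))^i / i!`
(`abelMean_elem`). The product asymptotics at `x = 0` convert `N^y` into `Γ(1+y)` times the
generating series of these functions, which is where the additional `Γ(1+y)` comes from. Errors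
`O(log^p N / N)` become `O((1-t) log^q(1-t))` (`small_abelMean`).

Finally, a polynomial is determined by such an asymptotic expansion, and every index is `1^m` or
`(l₊, 1^m)` (`index_cases`), so the same computations give existence and uniqueness. -/

/-- The nested sum `∑ f₁(m₁) ⋯ f_r(m_r)` over `lo < m₁ < ⋯ < m_r < N`. -/
noncomputable def nest : ℕ → List (ℕ → ℝ) → ℕ → ℝ
  | _, [], _ => 1
  | lo, f :: fs, N => ∑ n ∈ Ioo lo N, f n * nest n fs N

/-- The definition peels off the smallest variable; exchanging the order of summation peels off the
largest, the form needed for recurrences in `N`. -/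
theorem nest_concat (f : ℕ → ℝ) (fs : List (ℕ → ℝ)) (lo N : ℕ) :
    nest lo (fs ++ [f]) N = ∑ n ∈ Ioo lo N, f n * nest lo fs n := by
  induction fs generalizing lo with
  | nil => simp [nest]
  | cons g fs ih =>
    simp only [List.cons_append, nest, ih, mul_sum]
    rw [sum_comm' (t' := Ioo lo N) (s' := fun n => Ioo lo n)]
    · exact sum_congr rfl fun n _ => sum_congr rfl fun m _ => by ring
    · intro a b
      simp only [mem_Ioo]
      omega

/-- Splitting the double sum by which variable is smaller, or whether they agree, produces the three
terms of the stuffle recursion. -/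
theorem sum_Ioo_mul_sum_Ioo (f g : ℕ → ℝ) (lo N : ℕ) :
    (∑ n ∈ Ioo lo N, f n) * ∑ n ∈ Ioo lo N, g n =
      ∑ n ∈ Ioo lo N, f n * ∑ m ∈ Ioo n N, g m + ∑ n ∈ Ioo lo N, g n * ∑ m ∈ Ioo n N, f m
        + ∑ n ∈ Ioo lo N, f n * g n := by
  have h2 : ∑ n ∈ Ioo lo N, g n * ∑ m ∈ Ioo n N, f m =
      ∑ n ∈ Ioo lo N, f n * ∑ m ∈ Ioo lo n, g m := by
    simp only [mul_sum]
    rw [sum_comm' (t' := Ioo lo N) (s' := fun n => Ioo lo n)]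
    · exact sum_congr rfl fun n _ => sum_congr rfl fun m _ => by ring
    · intro a b
      simp only [mem_Ioo]
      omega
  rw [h2, sum_mul, ← sum_add_distrib, ← sum_add_distrib]
  refine sum_congr rfl fun n hn => ?_
  have : Ioo lo N = Ioo n N ∪ Ioo lo n ∪ {n} := by
    ext m
    simp only [mem_Ioo, mem_union, mem_singleton] at hn ⊢
    omega
  rw [this, sum_union, sum_union, sum_singleton]
  · ring
  · rw [disjoint_left]
    intro m
    simp only [mem_Ioo]
    omega
  · rw [disjoint_left]
    intro m
    simp only [mem_Ioo, mem_union, mem_singleton]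
    omega

/-- The factor `1 / (n + x) ^ a` of a nested sum. -/
noncomputable def factor (x : ℝ) (a : ℕ+) (n : ℕ) : ℝ := 1 / ((n : ℝ) + x) ^ (a : ℕ)

theorem factor_add (x : ℝ) (a b : ℕ+) (n : ℕ) :
    factor x (a + b) n = factor x a n * factor x b n := by
  simp only [factor, PNat.add_coe, pow_add]
  rw [div_mul_div_comm, one_mul]

/-- The sum of the terms of index `k` over `lo < m₁ < ⋯ < m_r < N`. -/
noncomputable def zetaBetween (x : ℝ) (lo : ℕ) (k : Index) (N : ℕ) : ℝ :=
  nest lo (k.map (factor x)) N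

@[simp]
theorem zetaBetween_nil (x : ℝ) (lo N : ℕ) : zetaBetween x lo [] N = 1 := rfl

theorem zetaBetween_cons (x : ℝ) (lo : ℕ) (a : ℕ+) (k : Index) (N : ℕ) :
    zetaBetween x lo (a :: k) N = ∑ n ∈ Ioo lo N, factor x a n * zetaBetween x n k N := rfl

theorem zetaBetween_concat (x : ℝ) (lo : ℕ) (a : ℕ+) (k : Index) (N : ℕ) :
    zetaBetween x lo (k ++ [a]) N = ∑ n ∈ Ioo lo N, factor x a n * zetaBetween x lo k n := by
  simp only [zetaBetween, List.map_append, List.map_cons, List.map_nil, nest_concat]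

/-- The lower bound stays general because the stuffle recursion acts on first entries, so the
inductive hypothesis is applied above the chosen smallest variable. -/
theorem sum_map_stuffle (x : ℝ) (lo N : ℕ) (k l : Index) :
    ((stuffle k l).map fun w => zetaBetween x lo w N).sum =
      zetaBetween x lo k N * zetaBetween x lo l N := by
  induction k, l using stuffle.induct generalizing lo with
  | case1 l => simp [stuffle]
  | case2 a k => simp [stuffle]
  | case3 a k b l ih1 ih2 ih3 =>
    have key (c : ℕ+) (s : Multiset Index) : ((s.map fun w => c :: w).map
        fun w => zetaBetween x lo w N).sum =
        ∑ n ∈ Ioo lo N, factor x c n * (s.map fun w => zetaBetween x n w N).sum := by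
      rw [Multiset.map_map]
      simp only [Function.comp_def, zetaBetween_cons, ← Multiset.sum_map_mul_left]
      induction s using Multiset.induction_on with
      | empty => simp
      | cons w s ih => simp [ih, sum_add_distrib]
    rw [stuffle, Multiset.map_add, Multiset.map_add, Multiset.sum_add, Multiset.sum_add,
      key, key, key]
    simp only [ih1, ih2, ih3, zetaBetween_cons, sum_Ioo_mul_sum_Ioo, factor_add]
    refine congrArg₂ _ (congrArg₂ _ ?_ ?_) ?_ <;> refine sum_congr rfl fun n _ => ?_ <;> ring

/-- Tuples of integers with `lo < m₁ < ⋯ < m_r < N`. -/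
noncomputable def chains (lo N r : ℕ) : Finset (Fin r → ℕ) := by
  classical exact (Fintype.piFinset fun _ : Fin r => Ioo lo N).filter StrictMono

theorem mem_chains {lo N r : ℕ} {m : Fin r → ℕ} :
    m ∈ chains lo N r ↔ (∀ i, lo < m i ∧ m i < N) ∧ StrictMono m := by
  simp [chains]

theorem sum_chains_succ (lo N r : ℕ) (G : (Fin (r + 1) → ℕ) → ℝ) :
    ∑ m ∈ chains lo N (r + 1), G m =
      ∑ n ∈ Ioo lo N, ∑ m ∈ chains n N r, G (Fin.cons n m) := by
  rw [sum_sigma']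
  refine sum_bij' (fun m _ => ⟨m 0, Fin.tail m⟩) (fun p _ => Fin.cons p.1 p.2) ?_ ?_ ?_ ?_ ?_
  · intro m hm
    obtain ⟨h1, h2⟩ := mem_chains.1 hm
    simp only [mem_sigma, mem_Ioo, mem_chains]
    exact ⟨h1 0, fun i => ⟨h2 (Fin.succ_pos i), (h1 _).2⟩, fun i j h => h2 (Fin.succ_lt_succ_iff.2 h)⟩
  · rintro ⟨n, m⟩ h
    simp only [mem_sigma, mem_Ioo, mem_chains] at h
    obtain ⟨h1, h2, h3⟩ := h
    refine mem_chains.2 ⟨?_, ?_⟩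
    · intro i
      refine Fin.cases ?_ (fun i => ?_) i
      · simpa using h1
      · simpa using ⟨h1.1.trans (h2 i).1, (h2 i).2⟩
    · intro i j
      refine Fin.cases ?_ (fun i => ?_) i <;> refine Fin.cases ?_ (fun j => ?_) j
      · simp
      · intro _
        simpa using (h2 j).1
      · simp
      · intro h
        simpa using h3 (Fin.succ_lt_succ_iff.1 h)
  · intro m _
    exact Fin.cons_self_tail m
  · intro p _
    simp
  · intro m _
    simp

theorem term_cons (x : ℝ) (a : ℕ+) (k : Index) (n : ℕ) (m : Fin k.length → ℕ) :
    term x (a :: k) (Fin.cons n m : Fin (k.length + 1) → ℕ) = factor x a n * term x k m := by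
  simp only [term, factor]
  rw [div_mul_div_comm, one_mul]
  congr 1
  exact Fin.prod_univ_succ (n := k.length) _

theorem sum_chains_term (x : ℝ) (k : Index) (lo N : ℕ) :
    ∑ m ∈ chains lo N k.length, term x k m = zetaBetween x lo k N := by
  induction k generalizing lo with
  | nil =>
    have : chains lo N (List.length ([] : Index)) = {fun i => i.elim0} := by
      ext m
      simp only [mem_chains, mem_singleton]
      exact ⟨fun _ => funext fun i => i.elim0, fun _ => ⟨fun i => i.elim0, fun i => i.elim0⟩⟩
    rw [this]
    simp [term]
  | cons a k ih =>
    rw [zetaBetween_cons]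
    refine (sum_chains_succ lo N k.length _).trans (sum_congr rfl fun n _ => ?_)
    rw [← ih, mul_sum]
    exact sum_congr rfl fun m _ => term_cons x a k n m

theorem zetaTrunc_eq (x : ℝ) (k : Index) (N : ℕ) : zetaTrunc x k N = zetaBetween x 0 k N := by
  rw [← sum_chains_term]
  rfl

/-- The last position of a non-empty index. -/
abbrev lastIdx {k : Index} (h : k ≠ []) : Fin k.length :=
  ⟨k.length - 1, Nat.sub_one_lt (mt List.length_eq_zero_iff.mp h)⟩

/-- The factors of the terms of index `k`, the last one multiplied by `g`. -/
noncomputable def weightedFactors (x : ℝ) (g : ℕ → ℝ) : Index → List (ℕ → ℝ)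
  | [] => []
  | [a] => [fun n => g n * factor x a n]
  | a :: b :: k => factor x a :: weightedFactors x g (b :: k)

theorem weightedFactors_concat (x : ℝ) (g : ℕ → ℝ) (k : Index) (a : ℕ+) :
    weightedFactors x g (k ++ [a]) = k.map (factor x) ++ [fun n => g n * factor x a n] := by
  induction k with
  | nil => rfl
  | cons b k ih =>
    cases k with
    | nil => rfl
    | cons c k => simpa [weightedFactors] using ih

theorem sum_chains_weighted (x : ℝ) (g : ℕ → ℝ) (k : Index) (h : k ≠ []) (lo N : ℕ) :
    ∑ m ∈ chains lo N k.length, g (m (lastIdx h)) * term x k m =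
      nest lo (weightedFactors x g k) N := by
  induction k generalizing lo with
  | nil => exact absurd rfl h
  | cons a k ih =>
    refine (sum_chains_succ lo N k.length _).trans ?_
    cases k with
    | nil =>
      simp only [weightedFactors, nest]
      refine sum_congr rfl fun n _ => ?_
      have := sum_chains_term x [] n N
      rw [zetaBetween_nil] at this
      rw [mul_assoc, ← this, mul_sum, mul_sum]
      refine sum_congr rfl fun m _ => ?_
      rw [term_cons]
      rfl
    | cons b k =>
      simp only [weightedFactors, nest]
      refine sum_congr rfl fun n _ => ?_
      rw [← ih (by simp), mul_sum]
      refine sum_congr rfl fun m _ => ?_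
      rw [term_cons]
      have : (Fin.cons n m : Fin ((b :: k).length + 1) → ℕ) (lastIdx h) =
          m (lastIdx (List.cons_ne_nil b k)) := rfl
      rw [this]
      ring

theorem sum_chains_concat (x : ℝ) (g : ℕ → ℝ) (k : Index) (a : ℕ+) (h : k ++ [a] ≠ []) (N : ℕ) :
    ∑ m ∈ chains 0 N (k ++ [a]).length, g (m (lastIdx h)) * term x (k ++ [a]) m =
      ∑ n ∈ Ioo 0 N, g n * factor x a n * zetaBetween x 0 k n := by
  rw [sum_chains_weighted, weightedFactors_concat, nest_concat]
  rfl

theorem term_pos {x : ℝ} (hx : |x| < 1) (k : Index) (m : Chain k.length) : 0 < term x k m.1 := by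
  refine one_div_pos.2 (prod_pos fun i _ => pow_pos ?_ _)
  have : (1 : ℝ) ≤ m.1 i := by exact_mod_cast m.2.2 i
  linarith [(abs_lt.1 hx).1]

/-- A series over chains with non-negative terms is the limit of its truncated sums. -/
theorem tsum_chain_eq {r : ℕ} (G : (Fin r → ℕ) → ℝ) (hG : ∀ m : Chain r, 0 ≤ G m.1) {L : ℝ}
    (hL : Filter.Tendsto (fun N => ∑ m ∈ chains 0 N r, G m) Filter.atTop (nhds L)) :
    ∑' m : Chain r, G m.1 = L := by
  classical
  let S : ℕ → Finset (Chain r) := fun N =>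
    (chains 0 N r).subtype fun m => StrictMono m ∧ ∀ i, 0 < m i
  have hS (N : ℕ) : ∑ m ∈ S N, G m.1 = ∑ m ∈ chains 0 N r, G m := by
    refine sum_subtype_of_mem G fun m hm => ?_
    obtain ⟨h1, h2⟩ := mem_chains.1 hm
    exact ⟨h2, fun i => (h1 i).1⟩
  have hmono : Monotone S := by
    intro M N h m hm
    simp only [S, mem_subtype, mem_chains] at hm ⊢
    exact ⟨fun i => ⟨(hm.1 i).1, (hm.1 i).2.trans_le h⟩, hm.2⟩
  have hex (m : Chain r) : ∃ N, m ∈ S N := by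
    refine ⟨∑ i, m.1 i + 1, ?_⟩
    simp only [S, mem_subtype, mem_chains]
    exact ⟨fun i => ⟨m.2.2 i, Nat.lt_succ_of_le
      (single_le_sum (f := m.1) (fun _ _ => Nat.zero_le _) (mem_univ i))⟩, m.2.1⟩
  have htop : Filter.Tendsto S Filter.atTop Filter.atTop :=
    Filter.tendsto_atTop_finset_of_monotone hmono hex
  have hL' : Filter.Tendsto (fun N => ∑ m ∈ S N, G m.1) Filter.atTop (nhds L) := by
    simpa only [hS] using hL
  have hsm : Monotone fun N => ∑ m ∈ S N, G m.1 := fun M N h =>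
    sum_le_sum_of_subset_of_nonneg (hmono h) fun m _ _ => hG m
  -- Every finite set of chains lies in some `S N`, and the sums over `S N` increase to `L`; so `L`
  -- bounds all finite sums.
  have hsum : Summable fun m : Chain r => G m.1 := by
    refine summable_of_sum_le (c := L) hG fun u => ?_
    obtain ⟨N, hN⟩ := (htop.eventually (Filter.eventually_ge_atTop u)).exists
    exact (sum_le_sum_of_subset_of_nonneg hN fun m _ _ => hG m).trans
      (hsm.ge_of_tendsto hL' N)
  exact tendsto_nhds_unique (hsum.hasSum.comp htop) hL'

end HurwitzMZV

/-! ### Star sums, complete symmetric functions and the exact product formula -/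

namespace HurwitzMZV

open Finset

theorem sum_map_finset_sum {ι : Type*} (s : Multiset ι) (t : Finset ℕ) (f : ι → ℕ → ℝ) :
    (s.map fun w => ∑ n ∈ t, f w n).sum = ∑ n ∈ t, (s.map fun w => f w n).sum := by
  induction s using Multiset.induction_on with
  | empty => simp
  | cons w s ih => simp [ih, sum_add_distrib]

/-- The sum of the terms of index `w` over `lo < m₁ < ⋯ < m_s = n`. -/
noncomputable def endAt (x : ℝ) (n : ℕ) : ℕ → Index → ℝ
  | _, [] => 0
  | _, [b] => factor x b n
  | lo, a :: b :: w => ∑ m ∈ Ioo lo n, factor x a m * endAt x n m (b :: w)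

theorem endAt_cons (x : ℝ) (n lo : ℕ) (a : ℕ+) {w : Index} (hw : w ≠ []) :
    endAt x n lo (a :: w) = ∑ m ∈ Ioo lo n, factor x a m * endAt x n m w := by
  cases w with
  | nil => exact absurd rfl hw
  | cons b w => rfl

theorem endAt_concat (x : ℝ) (n lo : ℕ) (w : Index) (b : ℕ+) :
    endAt x n lo (w ++ [b]) = factor x b n * zetaBetween x lo w n := by
  induction w generalizing lo with
  | nil => simp [endAt]
  | cons a w ih =>
    rw [List.cons_append, endAt_cons _ _ _ _ (by simp), zetaBetween_cons, mul_sum]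
    exact sum_congr rfl fun m _ => by rw [ih]; ring

theorem ne_nil_of_mem_starSum {l w : Index} (hl : l ≠ []) (hw : w ∈ starSum l) : w ≠ [] := by
  induction l using starSum.induct generalizing w with
  | case1 => exact absurd rfl hl
  | case2 a =>
    simp only [starSum, Multiset.mem_singleton] at hw
    simp [hw]
  | case3 a b l _ ih =>
    simp only [starSum, Multiset.mem_add, Multiset.mem_map] at hw
    rcases hw with ⟨v, _, rfl⟩ | hw
    · simp
    · exact ih (by simp) hw

/-- The sum of the terms of the formal sum `l^⋆` over `lo < m₁ ≤ ⋯ ≤ m_s = n`. -/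
noncomputable def starEndAt (x : ℝ) (n lo : ℕ) (l : Index) : ℝ :=
  ((starSum l).map (endAt x n lo)).sum

theorem starEndAt_singleton (x : ℝ) (n lo : ℕ) (a : ℕ+) :
    starEndAt x n lo [a] = factor x a n := by
  simp [starEndAt, starSum, endAt]

theorem starEndAt_cons_cons (x : ℝ) (n lo : ℕ) (a b : ℕ+) (l : Index) :
    starEndAt x n lo (a :: b :: l) =
      ∑ m ∈ Ioo lo n, factor x a m * starEndAt x n m (b :: l)
        + starEndAt x n lo ((a + b) :: l) := by
  simp only [starEndAt]
  rw [starSum, Multiset.map_add, Multiset.sum_add, Multiset.map_map]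
  congr 1
  simp only [← Multiset.sum_map_mul_left]
  rw [← sum_map_finset_sum]
  refine congrArg _ (Multiset.map_congr rfl fun w hw => ?_)
  exact endAt_cons _ _ _ _ (ne_nil_of_mem_starSum (by simp) hw)

/-- The power series `1 / (1 + a y)`. -/
noncomputable def geom (a : ℝ) : PowerSeries ℝ := PowerSeries.mk fun j => (-a) ^ j

theorem one_add_mul_geom (a : ℝ) : (1 + PowerSeries.C a * PowerSeries.X) * geom a = 1 := by
  ext n
  rw [add_mul, one_mul, mul_assoc, map_add, PowerSeries.coeff_C_mul]
  cases n with
  | zero => simp [geom]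
  | succ n => simp [geom, PowerSeries.coeff_succ_X_mul, PowerSeries.coeff_one, pow_succ]; ring

/-- The generating series of complete symmetric functions of `1 / (i + x)`, `m ≤ i ≤ n`,
with alternating signs. -/
noncomputable def completeSeries (x : ℝ) (n m : ℕ) : PowerSeries ℝ :=
  ∏ i ∈ Icc m n, geom (factor x 1 i)

/-- The complete symmetric function of degree `j` of `1 / (i + x)`, `m ≤ i ≤ n`. -/
noncomputable def complete (x : ℝ) (n m j : ℕ) : ℝ :=
  (-1) ^ j * PowerSeries.coeff j (completeSeries x n m)

theorem one_add_mul_completeSeries (x : ℝ) {n m : ℕ} (h : m ≤ n) :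
    (1 + PowerSeries.C (factor x 1 m) * PowerSeries.X) * completeSeries x n m =
      completeSeries x n (m + 1) := by
  have : Icc m n = insert m (Icc (m + 1) n) := by
    ext i
    simp only [mem_insert, mem_Icc]
    omega
  rw [completeSeries, this, prod_insert (by simp), ← mul_assoc, one_add_mul_geom, one_mul]
  rfl

theorem complete_zero (x : ℝ) (n m : ℕ) : complete x n m 0 = 1 := by
  simp [complete, completeSeries, map_prod, geom]

theorem complete_succ (x : ℝ) {n m : ℕ} (h : m ≤ n) (j : ℕ) :
    complete x n m (j + 1) = complete x n (m + 1) (j + 1) + factor x 1 m * complete x n m j := by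
  have := congrArg (PowerSeries.coeff (j + 1)) (one_add_mul_completeSeries x h)
  rw [add_mul, one_mul, mul_assoc, map_add, PowerSeries.coeff_C_mul,
    PowerSeries.coeff_succ_X_mul] at this
  simp only [complete, ← this, pow_succ]
  ring

theorem complete_self_succ (x : ℝ) (n j : ℕ) : complete x n (n + 1) (j + 1) = 0 := by
  simp [complete, completeSeries, PowerSeries.coeff_one]

/-- Monomials are sorted by their smallest variable; this iterates `complete_succ` down from the
empty range, where positive degrees vanish. -/
theorem complete_eq_sum (x : ℝ) (n j : ℕ) {lo : ℕ} (h : lo ≤ n) :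
    complete x n (lo + 1) (j + 1) = ∑ m ∈ Ioc lo n, factor x 1 m * complete x n m j := by
  induction h using Nat.decreasingInduction with
  | self => simp [complete_self_succ]
  | of_succ k hk ih =>
    have : Ioc k n = insert (k + 1) (Ioc (k + 1) n) := by
      ext i
      simp only [mem_insert, mem_Ioc]
      omega
    rw [this, sum_insert (by simp), ← ih, complete_succ x hk, add_comm]

theorem sum_Ioc_eq {lo n : ℕ} (h : lo < n) (f : ℕ → ℝ) :
    ∑ m ∈ Ioc lo n, f m = ∑ m ∈ Ioo lo n, f m + f n := by
  rw [← Ioo_insert_right h, sum_insert (by simp), add_comm]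

/-- With smallest variable `m` and largest variable `n` fixed, the `j` intermediate ones run freely
over `m ≤ ⋯ ≤ n`, giving a complete symmetric function. The first entry is arbitrary because the
plus branch of the star replaces `a` by `a + 1` in the induction. -/
theorem starEndAt_cons_ones (x : ℝ) (n j : ℕ) {lo : ℕ} (h : lo < n) (a : ℕ+) :
    starEndAt x n lo (a :: ones (j + 1)) =
      ∑ m ∈ Ioc lo n, factor x a m * factor x 1 n * complete x n m j := by
  induction j generalizing lo a with
  | zero =>
    simp only [ones, List.replicate_succ, List.replicate_zero, starEndAt_cons_cons,
      starEndAt_singleton, complete_zero, sum_Ioc_eq h, factor_add, mul_one]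
  | succ j ih =>
    have h1 (m : ℕ) (hm : m < n) :
        starEndAt x n m (1 :: ones (j + 1)) = factor x 1 n * complete x n (m + 1) (j + 1) := by
      rw [ih hm, complete_eq_sum x n j hm.le, mul_sum]
      exact sum_congr rfl fun i _ => by ring
    rw [show ones (j + 1 + 1) = 1 :: ones (j + 1) from rfl, starEndAt_cons_cons, ih h,
      sum_Ioc_eq h, sum_Ioc_eq h, complete_succ x le_rfl, complete_self_succ, ← add_assoc,
      ← sum_add_distrib]
    congr 1
    · refine sum_congr rfl fun m hm => ?_
      have hmn := (mem_Ioo.1 hm).2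
      rw [h1 m hmn, complete_succ x hmn.le, factor_add]
      ring
    · rw [factor_add]
      ring

theorem starEndAt_ones (x : ℝ) {n : ℕ} (h : 0 < n) (j : ℕ) :
    (-1) ^ j * starEndAt x n 0 (ones (j + 1)) =
      PowerSeries.coeff j (PowerSeries.C (factor x 1 n) * completeSeries x n 1) := by
  have key : starEndAt x n 0 (ones (j + 1)) = factor x 1 n * complete x n 1 j := by
    cases j with
    | zero => simp [ones, starEndAt_singleton, complete_zero]
    | succ j =>
      rw [show ones (j + 1 + 1) = 1 :: ones (j + 1) from rfl, starEndAt_cons_ones x n j h,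
        show (1 : ℕ) = 0 + 1 from rfl, complete_eq_sum x n j (Nat.zero_le n), mul_sum]
      exact sum_congr rfl fun i _ => by ring
  rw [key, complete, PowerSeries.coeff_C_mul, mul_left_comm, ← mul_assoc ((-1 : ℝ) ^ j),
    ← mul_pow]
  norm_num

/-- The merged last entry means that both chains end at the same `n`; below `n` the stuffle product
becomes an ordinary product. -/
theorem sum_map_circledast (x : ℝ) (N : ℕ) (k : Index) (a : ℕ+) {w : Index} (hw : w ≠ []) :
    ((circledast (k ++ [a]) w).map fun v => zetaBetween x 0 v N).sum =
      ∑ n ∈ Ioo 0 N, factor x a n * zetaBetween x 0 k n * endAt x n 0 w := by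
  obtain ⟨v, b, rfl⟩ : ∃ v b, w = v ++ [b] :=
    ⟨w.dropLast, w.getLast hw, (List.dropLast_append_getLast hw).symm⟩
  simp only [circledast, List.getLast?_append, List.getLast?_singleton, Option.some_or,
    List.dropLast_concat, Multiset.map_map, Function.comp_def, zetaBetween_concat, endAt_concat]
  rw [sum_map_finset_sum]
  refine sum_congr rfl fun n _ => ?_
  rw [Multiset.sum_map_mul_left, sum_map_stuffle, factor_add]
  ring

theorem sum_map_circledastStar (x : ℝ) (N : ℕ) (k : Index) (a : ℕ+) {l : Index} (hl : l ≠ []) :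
    ((circledastStar (k ++ [a]) l).map fun v => zetaBetween x 0 v N).sum =
      ∑ n ∈ Ioo 0 N, factor x a n * zetaBetween x 0 k n * starEndAt x n 0 l := by
  rw [circledastStar, Multiset.map_bind, Multiset.sum_bind,
    Multiset.map_congr rfl fun w hw => sum_map_circledast x N k a (ne_nil_of_mem_starSum hl hw),
    sum_map_finset_sum]
  exact sum_congr rfl fun n _ => by rw [Multiset.sum_map_mul_left, starEndAt]

/-- The generating polynomial `∏ (1 + y / (n + x))` over `0 < n < N`. -/
noncomputable def onesSeries (x : ℝ) (N : ℕ) : PowerSeries ℝ :=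
  ∏ n ∈ Ioo 0 N, (1 + PowerSeries.C (factor x 1 n) * PowerSeries.X)

/-- The truncation of the series `starSeries`. -/
noncomputable def starTrunc (x : ℝ) (k : Index) (N : ℕ) : PowerSeries ℝ :=
  PowerSeries.mk fun m =>
    (-1) ^ m * ((circledastStar k (ones (m + 1))).map fun w => zetaTrunc x w N).sum

theorem Ioo_zero_succ {N : ℕ} (h : 0 < N) : Ioo 0 (N + 1) = insert N (Ioo 0 N) := by
  ext i
  simp only [mem_insert, mem_Ioo]
  omega

theorem zetaBetween_concat_succ (x : ℝ) {N : ℕ} (h : 0 < N) (k : Index) (a : ℕ+) :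
    zetaBetween x 0 (k ++ [a]) (N + 1) =
      zetaBetween x 0 (k ++ [a]) N + factor x a N * zetaBetween x 0 k N := by
  rw [zetaBetween_concat, Ioo_zero_succ h, sum_insert (by simp), ← zetaBetween_concat, add_comm]

theorem ones_succ (m : ℕ) : ones (m + 1) = ones m ++ [1] := List.replicate_succ'

theorem onesSeries_succ (x : ℝ) {N : ℕ} (h : 0 < N) :
    onesSeries x (N + 1) =
      (1 + PowerSeries.C (factor x 1 N) * PowerSeries.X) * onesSeries x N := by
  rw [onesSeries, Ioo_zero_succ h, prod_insert (by simp)]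
  rfl

theorem onesSeries_mul_completeSeries (x : ℝ) (n : ℕ) :
    onesSeries x (n + 1) * completeSeries x n 1 = 1 := by
  have : Ioo 0 (n + 1) = Icc 1 n := by
    ext i
    simp only [mem_Icc, mem_Ioo]
    omega
  rw [onesSeries, completeSeries, this, ← prod_mul_distrib]
  exact prod_eq_one fun i _ => one_add_mul_geom _

theorem starTrunc_concat (x : ℝ) (k : Index) (a : ℕ+) (N : ℕ) :
    starTrunc x (k ++ [a]) N = ∑ n ∈ Ioo 0 N,
      PowerSeries.C (factor x a n * zetaBetween x 0 k n) *
        (PowerSeries.C (factor x 1 n) * completeSeries x n 1) := by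
  ext m
  simp only [starTrunc, PowerSeries.coeff_mk, zetaTrunc_eq, map_sum]
  rw [sum_map_circledastStar x N k a (by simp [ones]), mul_sum]
  refine sum_congr rfl fun n hn => ?_
  rw [PowerSeries.coeff_C_mul, ← starEndAt_ones x (mem_Ioo.1 hn).1]
  ring

theorem plus_concat (k : Index) (a : ℕ+) : plus (k ++ [a]) = k ++ [a + 1] := by
  simp [plus]

/-- Either the new value `N` is not used, or it is the last variable: it then consumes a trailing
one, shifting the power of `y`, or the entry `a` when no ones remain. -/
theorem mk_concat_ones_succ (x : ℝ) {N : ℕ} (h : 0 < N) (k : Index) (a : ℕ+) :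
    (PowerSeries.mk fun m => zetaBetween x 0 ((k ++ [a]) ++ ones m) (N + 1)) =
      (1 + PowerSeries.C (factor x 1 N) * PowerSeries.X) *
        (PowerSeries.mk fun m => zetaBetween x 0 ((k ++ [a]) ++ ones m) N) +
      PowerSeries.C (factor x a N * zetaBetween x 0 k N) := by
  ext m
  rw [add_mul, one_mul, mul_assoc]
  simp only [map_add, PowerSeries.coeff_C_mul, PowerSeries.coeff_mk, PowerSeries.coeff_C]
  cases m with
  | zero => simp [ones, zetaBetween_concat_succ x h]
  | succ m =>
    rw [PowerSeries.coeff_succ_X_mul, ones_succ, ← List.append_assoc,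
      zetaBetween_concat_succ x h]
    simp

/-- The generating series of the truncated sums of `(k₊, 1, …, 1)` is the product of
those of `(1, …, 1)` and of `k ⊛ (1, …, 1)^⋆`. -/
theorem mk_plus_ones (x : ℝ) {k : Index} (hk : k ≠ []) (N : ℕ) :
    (PowerSeries.mk fun m => zetaTrunc x (plus k ++ ones m) N) =
      onesSeries x N * starTrunc x k N := by
  obtain ⟨k, a, rfl⟩ : ∃ v b, k = v ++ [b] :=
    ⟨k.dropLast, k.getLast hk, (List.dropLast_append_getLast hk).symm⟩
  simp only [plus_concat, zetaTrunc_eq, starTrunc_concat]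
  have h0 (N : ℕ) (hN : Ioo 0 N = ∅) :
      (PowerSeries.mk fun m => zetaBetween x 0 ((k ++ [a + 1]) ++ ones m) N) = 0 := by
    ext m
    rw [PowerSeries.coeff_mk]
    cases m with
    | zero => simp [ones, zetaBetween_concat, hN]
    | succ m => rw [ones_succ, ← List.append_assoc, zetaBetween_concat, hN]; simp
  induction N with
  | zero => rw [h0 0 (by simp)]; simp
  | succ N ih =>
    -- Passing from `0` to `1` adds no summation variable, since the interval excludes `0`; the
    -- recurrence starts at `N = 1`.
    rcases Nat.eq_zero_or_pos N with rfl | h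
    · rw [h0 1 (by ext i; simp; omega), show Ioo 0 (0 + 1) = ∅ by ext i; simp; omega]
      simp
    · rw [mk_concat_ones_succ x h, ih, Ioo_zero_succ h, sum_insert (by simp), mul_add,
        ← mul_assoc, ← onesSeries_succ x h, add_comm]
      congr 1
      -- The new summand contains the inverse of `onesSeries x (N + 1)`, so what survives is the
      -- inhomogeneous term of the recurrence.
      rw [mul_left_comm, mul_left_comm (onesSeries x (N + 1)), onesSeries_mul_completeSeries,
        mul_one, ← map_mul, factor_add]
      congr 1
      ring

theorem mk_ones (x : ℝ) (N : ℕ) :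
    (PowerSeries.mk fun m => zetaTrunc x (ones m) N) = onesSeries x N := by
  simp only [zetaTrunc_eq]
  have h0 (N : ℕ) (hN : Ioo 0 N = ∅) :
      (PowerSeries.mk fun m => zetaBetween x 0 (ones m) N) = 1 := by
    ext m
    rw [PowerSeries.coeff_mk, PowerSeries.coeff_one]
    cases m with
    | zero => simp [ones]
    | succ m => rw [ones_succ, zetaBetween_concat, hN]; simp
  induction N with
  | zero => rw [h0 0 (by simp), onesSeries]; simp
  | succ N ih =>
    rcases Nat.eq_zero_or_pos N with rfl | h
    · rw [h0 1 (by ext i; simp; omega), onesSeries, show Ioo 0 (0 + 1) = ∅ by ext i; simp; omega]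
      simp
    · rw [onesSeries_succ x h, ← ih]
      ext m
      rw [add_mul, one_mul, mul_assoc]
      simp only [map_add, PowerSeries.coeff_C_mul, PowerSeries.coeff_mk]
      cases m with
      | zero => simp [ones]
      | succ m =>
        rw [PowerSeries.coeff_succ_X_mul, ones_succ, zetaBetween_concat_succ x h,
          PowerSeries.coeff_mk]

end HurwitzMZV

/-! ### Logarithmic growth and convergence of admissible sums -/

namespace HurwitzMZV

open Finset Filter

/-- The logarithmic scale `1 + log N`. -/
noncomputable def logScale (N : ℕ) : ℝ := 1 + Real.log N

/-- The shift by `1` keeps the scale away from zero at `N = 1`, so bounds can be imposed at every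
positive `N` and exponents may be raised freely. -/
theorem one_le_logScale (N : ℕ) : 1 ≤ logScale N := by
  have := Real.log_natCast_nonneg N
  simp only [logScale]
  linarith

theorem logScale_pow_mono (N : ℕ) {p q : ℕ} (h : p ≤ q) : logScale N ^ p ≤ logScale N ^ q :=
  pow_le_pow_right₀ (one_le_logScale N) h

theorem logScale_mono {M N : ℕ} (h0 : 0 < M) (h : M ≤ N) : logScale M ≤ logScale N := by
  have : (0 : ℝ) < M := by exact_mod_cast h0
  have h' : (M : ℝ) ≤ N := by exact_mod_cast h
  have := Real.log_le_log this h'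
  simp only [logScale]
  linarith

/-- `f` grows at most like a power of `log N`. -/
def Slow (f : ℕ → ℝ) : Prop :=
  ∃ (C : ℝ) (p : ℕ), ∀ N : ℕ, 0 < N → |f N| ≤ C * logScale N ^ p

/-- `f` decays like `N⁻¹` times a power of `log N`. -/
def Small (f : ℕ → ℝ) : Prop :=
  ∃ (C : ℝ) (p : ℕ), ∀ N : ℕ, 0 < N → |f N| ≤ C * logScale N ^ p / N

theorem small_iff {f : ℕ → ℝ} : Small f ↔ Slow fun N => f N * N := by
  refine exists_congr fun C => exists_congr fun p => forall_congr' fun N => ?_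
  refine imp_congr_right fun hN => ?_
  have : (0 : ℝ) < N := by exact_mod_cast hN
  rw [le_div_iff₀ this, abs_mul, Nat.abs_cast]

theorem Slow.congr {f g : ℕ → ℝ} (hf : Slow f) (h : ∀ N, 0 < N → f N = g N) : Slow g := by
  obtain ⟨C, p, hC⟩ := hf
  exact ⟨C, p, fun N hN => h N hN ▸ hC N hN⟩

theorem slow_const (c : ℝ) : Slow fun _ => c := ⟨|c|, 0, fun N _ => by simp⟩

theorem Slow.add {f g : ℕ → ℝ} (hf : Slow f) (hg : Slow g) : Slow fun N => f N + g N := by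
  obtain ⟨C, p, hC⟩ := hf
  obtain ⟨D, q, hD⟩ := hg
  refine ⟨|C| + |D|, p + q, fun N hN => ?_⟩
  have h1 := logScale_pow_mono N (Nat.le_add_right p q)
  have h2 := logScale_pow_mono N (Nat.le_add_left q p)
  have h0 : (0 : ℝ) ≤ logScale N := zero_le_one.trans (one_le_logScale N)
  calc |f N + g N| ≤ |f N| + |g N| := abs_add_le _ _
    _ ≤ |C| * logScale N ^ p + |D| * logScale N ^ q := by
        refine add_le_add ((hC N hN).trans ?_) ((hD N hN).trans ?_) <;>
          exact mul_le_mul_of_nonneg_right (le_abs_self _) (by positivity)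
    _ ≤ |C| * logScale N ^ (p + q) + |D| * logScale N ^ (p + q) := by gcongr
    _ = _ := by ring

theorem Slow.mul {f g : ℕ → ℝ} (hf : Slow f) (hg : Slow g) : Slow fun N => f N * g N := by
  obtain ⟨C, p, hC⟩ := hf
  obtain ⟨D, q, hD⟩ := hg
  refine ⟨C * D, p + q, fun N hN => ?_⟩
  rw [abs_mul]
  refine (mul_le_mul (hC N hN) (hD N hN) (abs_nonneg _) ((abs_nonneg _).trans (hC N hN))).trans ?_
  rw [pow_add]
  exact le_of_eq (by ring)

theorem Slow.sum {ι : Type*} (s : Finset ι) {f : ι → ℕ → ℝ} (h : ∀ i ∈ s, Slow (f i)) :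
    Slow fun N => ∑ i ∈ s, f i N := by
  classical
  induction s using Finset.induction_on with
  | empty => simpa using slow_const 0
  | insert a s ha ih =>
    simp only [sum_insert ha]
    exact (h a (mem_insert_self a s)).add (ih fun i hi => h i (mem_insert_of_mem hi))

theorem slow_log : Slow fun N => Real.log N := by
  refine ⟨1, 1, fun N _ => ?_⟩
  rw [abs_of_nonneg (Real.log_natCast_nonneg N), logScale]
  linarith

theorem Slow.pow {f : ℕ → ℝ} (hf : Slow f) (i : ℕ) : Slow fun N => f N ^ i := by
  induction i with
  | zero => simpa using slow_const 1
  | succ i ih => simpa only [pow_succ] using ih.mul hf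

theorem Slow.of_le {f g : ℕ → ℝ} (hg : Slow g) (h : ∀ N, 0 < N → |f N| ≤ g N) : Slow f := by
  obtain ⟨C, p, hC⟩ := hg
  exact ⟨C, p, fun N hN => (h N hN).trans ((le_abs_self _).trans (hC N hN))⟩

theorem Small.add {f g : ℕ → ℝ} (hf : Small f) (hg : Small g) : Small fun N => f N + g N := by
  rw [small_iff] at *
  simpa only [add_mul] using hf.add hg

theorem Slow.mul_small {f g : ℕ → ℝ} (hf : Slow f) (hg : Small g) :
    Small fun N => f N * g N := by
  rw [small_iff] at *
  simpa only [mul_assoc] using hf.mul hg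

theorem Small.sum {ι : Type*} (s : Finset ι) {f : ι → ℕ → ℝ} (h : ∀ i ∈ s, Small (f i)) :
    Small fun N => ∑ i ∈ s, f i N := by
  simp only [small_iff] at *
  simpa only [sum_mul] using Slow.sum s h

theorem Small.congr {f g : ℕ → ℝ} (hf : Small f) (h : ∀ N, 0 < N → f N = g N) : Small g := by
  obtain ⟨C, p, hC⟩ := hf
  exact ⟨C, p, fun N hN => h N hN ▸ hC N hN⟩

theorem Small.slow {f : ℕ → ℝ} (hf : Small f) : Slow f := by
  obtain ⟨C, p, hC⟩ := hf
  refine ⟨C, p, fun N hN => (hC N hN).trans ?_⟩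
  have h1 : (1 : ℝ) ≤ N := by exact_mod_cast hN
  have h2 := (abs_nonneg _).trans (hC N hN)
  rw [le_div_iff₀ (by linarith), zero_mul] at h2
  exact div_le_self h2 h1

/-! ### Elementary symmetric functions as a substitute for powers of the logarithm -/

/-- The truncated sums of the index `(1, …, 1)` at `x = 0`, i.e. the elementary symmetric
functions of `1, 1/2, …, 1/(N-1)`. -/
noncomputable def elem (i N : ℕ) : ℝ := zetaBetween 0 0 (ones i) N

/-- The sum of the elementary symmetric functions of degree at most `p`. -/
noncomputable def elemSum (p N : ℕ) : ℝ := ∑ i ∈ range (p + 1), elem i N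

theorem elem_zero (N : ℕ) : elem 0 N = 1 := rfl

theorem factor_zero_one (n : ℕ) : factor 0 1 n = 1 / n := by simp [factor]

theorem elem_succ (i N : ℕ) : elem (i + 1) N = ∑ n ∈ Ioo 0 N, 1 / (n : ℝ) * elem i n := by
  simp only [elem, ones_succ, zetaBetween_concat, factor_zero_one]

theorem elem_succ_succ (i : ℕ) {N : ℕ} (h : 0 < N) :
    elem (i + 1) (N + 1) = elem (i + 1) N + 1 / N * elem i N := by
  rw [elem_succ, Ioo_zero_succ h, sum_insert (by simp), ← elem_succ, add_comm]

theorem elem_nonneg (i N : ℕ) : 0 ≤ elem i N := by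
  induction i generalizing N with
  | zero => simp [elem_zero]
  | succ i ih =>
    rw [elem_succ]
    exact sum_nonneg fun n _ => mul_nonneg (by positivity) (ih n)

theorem elem_succ_one (i : ℕ) : elem (i + 1) 1 = 0 := by
  rw [elem_succ]
  exact sum_eq_zero fun n hn => by simp at hn; omega

theorem elem_one_eq {N : ℕ} : elem 1 (N + 1) = (harmonic N : ℝ) := by
  induction N with
  | zero => simp [elem_succ_one 0]
  | succ N ih => rw [elem_succ_succ 0 (Nat.succ_pos N), ih, harmonic_succ, elem_zero]; simp

theorem elem_le (i : ℕ) {N : ℕ} (h : 0 < N) : elem i N ≤ logScale N ^ i := by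
  induction i generalizing N with
  | zero => simp [elem_zero]
  | succ i ih =>
    have h1 : elem 1 N ≤ logScale N := by
      obtain ⟨M, rfl⟩ := Nat.exists_eq_succ_of_ne_zero h.ne'
      rw [Nat.succ_eq_add_one, elem_one_eq]
      rcases Nat.eq_zero_or_pos M with rfl | hM
      · simp [logScale]
      · exact (harmonic_le_one_add_log M).trans (logScale_mono hM (Nat.le_succ M))
    have h2 : 0 ≤ logScale N := zero_le_one.trans (one_le_logScale N)
    calc elem (i + 1) N = ∑ n ∈ Ioo 0 N, 1 / (n : ℝ) * elem i n := elem_succ i N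
      _ ≤ ∑ n ∈ Ioo 0 N, 1 / (n : ℝ) * elem 0 n * logScale N ^ i := by
          refine sum_le_sum fun n hn => ?_
          rw [mem_Ioo] at hn
          rw [elem_zero, mul_one]
          refine mul_le_mul_of_nonneg_left ((ih hn.1).trans ?_) (by positivity)
          exact pow_le_pow_left₀ (zero_le_one.trans (one_le_logScale n))
            (logScale_mono hn.1 hn.2.le) i
      _ = elem 1 N * logScale N ^ i := by rw [← sum_mul, ← elem_succ]
      _ ≤ logScale N ^ (i + 1) := by
          rw [pow_succ, mul_comm]
          exact mul_le_mul_of_nonneg_left h1 (by positivity)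

theorem slow_elem (i : ℕ) : Slow (elem i) :=
  ⟨1, i, fun N hN => by rw [abs_of_nonneg (elem_nonneg i N), one_mul]; exact elem_le i hN⟩

/-- Expanding the product gives `(i+1) e_{i+1}` plus monomials with one squared variable; as `1/n ≤
1`, these contribute at most `i e_i`. The induction on `N` proves a slightly weaker bound. -/
theorem elem_one_mul_le (i : ℕ) {N : ℕ} (h : 0 < N) :
    elem 1 N * elem i N ≤ (i + 1) * (elem (i + 1) N + elem i N) := by
  induction N, h using Nat.le_induction generalizing i with
  | base =>
    rw [show elem 1 (Nat.succ 0) = 0 from elem_succ_one 0, zero_mul]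
    exact mul_nonneg (by positivity) (add_nonneg (elem_nonneg _ _) (elem_nonneg _ _))
  | succ N hN ih =>
    have hN' : 0 < N := hN
    have h1 : (1 : ℝ) ≤ N := by exact_mod_cast hN
    have ha : (0 : ℝ) ≤ 1 / N := by positivity
    have ha1 : (1 : ℝ) / N ≤ 1 := by rw [div_le_one (by linarith)]; exact h1
    rw [elem_succ_succ 0 hN', elem_zero, mul_one]
    cases i with
    | zero =>
      rw [zero_add, elem_succ_succ 0 hN', elem_zero, elem_zero, Nat.cast_zero]
      linarith
    | succ i =>
      rw [elem_succ_succ i hN', elem_succ_succ (i + 1) hN']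
      have h2 := ih (i + 1)
      have h3 := mul_le_mul_of_nonneg_left (ih i) ha
      have h4 : 1 / (N : ℝ) * (1 / N * elem i N) ≤ 1 / N * elem i N :=
        mul_le_of_le_one_left (mul_nonneg ha (elem_nonneg _ _)) ha1
      push_cast at h2 h3 ⊢
      generalize (1 : ℝ) / N = a at *
      linarith

theorem elemSum_nonneg (p N : ℕ) : 0 ≤ elemSum p N := sum_nonneg fun i _ => elem_nonneg i N

theorem elemSum_mono (p N : ℕ) : elemSum p N ≤ elemSum (p + 1) N := by
  rw [elemSum, elemSum, sum_range_succ _ (p + 1)]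
  exact le_add_of_nonneg_right (elem_nonneg _ _)

theorem elem_one_mul_elemSum_le (p : ℕ) {N : ℕ} (h : 0 < N) :
    elem 1 N * elemSum p N ≤ 2 * (p + 1) * elemSum (p + 1) N := by
  calc elem 1 N * elemSum p N = ∑ i ∈ range (p + 1), elem 1 N * elem i N := by
        rw [elemSum, mul_sum]
    _ ≤ ∑ i ∈ range (p + 1), ((p : ℝ) + 1) * (elem (i + 1) N + elem i N) := by
        refine sum_le_sum fun i hi => (elem_one_mul_le i h).trans ?_
        have : (i : ℝ) ≤ p := by exact_mod_cast Nat.lt_succ_iff.1 (mem_range.1 hi)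
        have := add_nonneg (elem_nonneg (i + 1) N) (elem_nonneg i N)
        gcongr
    _ = (p + 1) * (∑ i ∈ range (p + 1), elem (i + 1) N + elemSum p N) := by
        rw [← mul_sum, sum_add_distrib, elemSum]
    _ ≤ (p + 1) * (elemSum (p + 1) N + elemSum (p + 1) N) := by
        have : ∑ i ∈ range (p + 1), elem (i + 1) N ≤ elemSum (p + 1) N := by
          rw [elemSum, sum_range_succ' _ (p + 1)]
          exact le_add_of_nonneg_right (elem_nonneg _ _)
        have := elemSum_mono p N
        gcongr
    _ = _ := by ring

/-- Converse to `elem_le`: logarithmic majorants can be replaced by combinations of elementary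
symmetric functions, whose Abel means are explicit. -/
theorem logScale_pow_le_elemSum (p : ℕ) :
    ∃ C : ℝ, 0 ≤ C ∧ ∀ N : ℕ, 0 < N → logScale N ^ p ≤ C * elemSum p N := by
  induction p with
  | zero => exact ⟨1, zero_le_one, fun N _ => by simp [elemSum, elem_zero]⟩
  | succ p ih =>
    obtain ⟨C, hC, h⟩ := ih
    refine ⟨C * (1 + 2 * (p + 1)), by positivity, fun N hN => ?_⟩
    have h1 : logScale N ≤ 1 + elem 1 N := by
      obtain ⟨M, rfl⟩ := Nat.exists_eq_succ_of_ne_zero hN.ne'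
      rw [Nat.succ_eq_add_one, elem_one_eq, logScale]
      exact add_le_add_right (log_add_one_le_harmonic M) 1
    have h0 : 0 ≤ logScale N := zero_le_one.trans (one_le_logScale N)
    calc logScale N ^ (p + 1) = logScale N * logScale N ^ p := pow_succ' _ _
      _ ≤ (1 + elem 1 N) * (C * elemSum p N) := by
          gcongr
          · exact add_nonneg zero_le_one (elem_nonneg _ _)
          · exact h N hN
      _ = C * (elemSum p N + elem 1 N * elemSum p N) := by ring
      _ ≤ C * (elemSum (p + 1) N + 2 * (p + 1) * elemSum (p + 1) N) := by
          have := elemSum_mono p N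
          have := elem_one_mul_elemSum_le p hN
          gcongr
      _ = _ := by ring

theorem elemSum_succ (p : ℕ) {N : ℕ} (h : 0 < N) :
    elemSum p (N + 1) = elemSum p N + 1 / N * (elemSum p N - elem p N) := by
  simp only [elemSum]
  rw [sum_range_succ' _ p, sum_range_succ _ p, add_sub_cancel_right,
    sum_congr rfl fun i _ => elem_succ_succ i h, sum_add_distrib, ← mul_sum,
    ← sum_range_succ _ p, sum_range_succ' (fun i => elem i N) p, elem_zero, elem_zero]
  ring

/-- An exact discrete antiderivative: tails of sums of `elem p N / (N (N + 1))` telescope, without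
any integral comparison. -/
theorem elemSum_div_sub (p : ℕ) {N : ℕ} (h : 0 < N) :
    elemSum p N / N - elemSum p (N + 1) / (N + 1) = elem p N / (N * (N + 1)) := by
  have : (0 : ℝ) < N := by exact_mod_cast h
  rw [elemSum_succ p h]
  field_simp
  ring

theorem slow_elemSum (p : ℕ) : Slow (elemSum p) := Slow.sum _ fun i _ => slow_elem i

theorem factor_nonneg {x : ℝ} (hx : |x| < 1) (a : ℕ+) {n : ℕ} (h : 0 < n) :
    0 ≤ factor x a n := by
  have h1 : (1 : ℝ) ≤ n := by exact_mod_cast h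
  have := (abs_lt.1 hx).1
  exact one_div_nonneg.2 (pow_nonneg (by linarith) _)

theorem factor_le {x : ℝ} (hx : |x| < 1) (a : ℕ+) {n : ℕ} (h : 0 < n) :
    factor x a n ≤ (1 / (1 - |x|)) ^ (a : ℕ) * (1 / (n : ℝ) ^ (a : ℕ)) := by
  have h1 : (1 : ℝ) ≤ n := by exact_mod_cast h
  have h2 : 0 < 1 - |x| := by linarith
  rw [factor, one_div_pow, one_div_mul_one_div, ← mul_pow]
  have h3 : (1 - |x|) * n ≤ n + x := by
    have := neg_abs_le x
    have := mul_le_mul_of_nonneg_left h1 (abs_nonneg x)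
    linarith
  exact one_div_le_one_div_of_le (by positivity) (pow_le_pow_left₀ (by positivity) h3 _)

theorem zetaBetween_nonneg {x : ℝ} (hx : |x| < 1) (k : Index) (N : ℕ) :
    0 ≤ zetaBetween x 0 k N := by
  induction k using List.reverseRecOn generalizing N with
  | nil => simp
  | append_singleton k a ih =>
    rw [zetaBetween_concat]
    exact sum_nonneg fun n hn => mul_nonneg (factor_nonneg hx a (mem_Ioo.1 hn).1) (ih n)

theorem zetaBetween_le_elem {x : ℝ} (hx : |x| < 1) (k : Index) :
    ∃ C : ℝ, 0 ≤ C ∧ ∀ N, zetaBetween x 0 k N ≤ C * elem k.length N := by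
  induction k using List.reverseRecOn with
  | nil => exact ⟨1, zero_le_one, fun N => by simp [elem_zero]⟩
  | append_singleton k a ih =>
    obtain ⟨C, hC, h⟩ := ih
    have h2 : 0 < 1 - |x| := by linarith
    refine ⟨(1 / (1 - |x|)) ^ (a : ℕ) * C, by positivity, fun N => ?_⟩
    rw [zetaBetween_concat, List.length_append, List.length_singleton, elem_succ, mul_sum]
    refine sum_le_sum fun n hn => ?_
    have hn0 := (mem_Ioo.1 hn).1
    have h1 : (1 : ℝ) ≤ n := by exact_mod_cast hn0
    have h3 : factor x a n ≤ (1 / (1 - |x|)) ^ (a : ℕ) * (1 / n) := by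
      refine (factor_le hx a hn0).trans ?_
      gcongr
      exact le_self_pow₀ h1 a.pos.ne'
    calc factor x a n * zetaBetween x 0 k n
        ≤ (1 / (1 - |x|)) ^ (a : ℕ) * (1 / n) * (C * elem k.length n) :=
          mul_le_mul h3 (h n) (zetaBetween_nonneg hx k n) (by positivity)
      _ = _ := by ring

theorem slow_zetaBetween {x : ℝ} (hx : |x| < 1) (k : Index) : Slow (zetaBetween x 0 k) := by
  obtain ⟨C, _, h⟩ := zetaBetween_le_elem hx k
  refine ((slow_const C).mul (slow_elem k.length)).of_le fun N _ => ?_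
  rw [abs_of_nonneg (zetaBetween_nonneg hx k N)]
  exact h N

/-- The truncated sums of an admissible index converge to the multiple zeta value. -/
theorem small_zetaTrunc_sub {x : ℝ} (hx : |x| < 1) (k : Index) {a : ℕ+} (ha : 2 ≤ (a : ℕ)) :
    Small fun N => zetaTrunc x (k ++ [a]) N - zeta x (k ++ [a]) := by
  simp only [zetaTrunc_eq]
  obtain ⟨C, hC, hle⟩ := zetaBetween_le_elem hx k
  set Z : ℕ → ℝ := fun N => zetaBetween x 0 (k ++ [a]) N with hZ
  have h2 : 0 < 1 - |x| := by linarith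
  -- The factor `2` comes from `1/N^a ≤ 2/(N(N+1))` for `a ≥ 2`.
  set K : ℝ := 2 * ((1 / (1 - |x|)) ^ (a : ℕ) * C) with hK
  have hK0 : 0 ≤ K := by positivity
  set V : ℕ → ℝ := fun N => elemSum k.length N / N with hV
  have hV0 (N : ℕ) : 0 ≤ V N := div_nonneg (elemSum_nonneg _ _) (Nat.cast_nonneg N)
  have hstep {N : ℕ} (hN : 0 < N) : Z (N + 1) - Z N ≤ K * (V N - V (N + 1)) := by
    have h1 : (1 : ℝ) ≤ N := by exact_mod_cast hN
    simp only [hZ, zetaBetween_concat_succ x hN, hV]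
    push_cast
    rw [elemSum_div_sub _ hN, add_sub_cancel_left]
    have h3 : factor x a N ≤ (1 / (1 - |x|)) ^ (a : ℕ) * (2 / (N * (N + 1))) := by
      refine (factor_le hx a hN).trans ?_
      refine mul_le_mul_of_nonneg_left ?_ (by positivity)
      rw [div_le_div_iff₀ (by positivity) (by positivity)]
      have : (N : ℝ) ^ 2 ≤ N ^ (a : ℕ) := pow_le_pow_right₀ h1 ha
      nlinarith
    calc factor x a N * zetaBetween x 0 k N
        ≤ (1 / (1 - |x|)) ^ (a : ℕ) * (2 / (N * (N + 1))) * (C * elem k.length N) :=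
          mul_le_mul h3 (hle N) (zetaBetween_nonneg hx k N) (by positivity)
      _ = _ := by rw [hK]; ring
  have hmono : Monotone Z := by
    refine monotone_nat_of_le_succ fun N => ?_
    rcases Nat.eq_zero_or_pos N with rfl | hN
    · simp only [hZ, zetaBetween_concat]
      exact le_of_eq (by rw [show Ioo 0 (0 + 1) = ∅ by ext i; simp; omega]; simp)
    · simp only [hZ, zetaBetween_concat_succ x hN]
      exact le_add_of_nonneg_right
        (mul_nonneg (factor_nonneg hx a hN) (zetaBetween_nonneg hx k N))
  -- `Z` increases while `Z + K * V` decreases on positive `N`, so the limit is trapped between `Z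
  -- N` and `Z N + K * V N`.
  have hanti {M N : ℕ} (hM : 0 < M) (h : M ≤ N) : Z N + K * V N ≤ Z M + K * V M := by
    induction N, h using Nat.le_induction with
    | base => exact le_rfl
    | succ N hN ih =>
      have := hstep (hM.trans_le hN)
      linarith
  have hbound {M : ℕ} (hM : 0 < M) (N : ℕ) : Z N ≤ Z M + K * V M := by
    rcases le_total M N with h | h
    · have := hanti hM h
      have := mul_nonneg hK0 (hV0 N)
      linarith
    · have := hmono h
      have := mul_nonneg hK0 (hV0 M)
      linarith
  have hbdd : BddAbove (Set.range Z) :=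
    ⟨Z 1 + K * V 1, by rintro _ ⟨N, rfl⟩; exact hbound one_pos N⟩
  have hlim := tendsto_atTop_ciSup hmono hbdd
  have hzeta : zeta x (k ++ [a]) = ⨆ N, Z N := by
    refine tsum_chain_eq (term x (k ++ [a])) (fun m => (term_pos hx _ m).le) ?_
    simpa only [sum_chains_term] using hlim
  have hslow : Slow fun N => K * elemSum k.length N := (slow_const K).mul (slow_elemSum _)
  rw [small_iff]
  refine hslow.of_le fun N hN => ?_
  have hN' : (0 : ℝ) < N := by exact_mod_cast hN
  have h3 : Z N ≤ zeta x (k ++ [a]) := hzeta ▸ le_ciSup hbdd N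
  have h4 : zeta x (k ++ [a]) ≤ Z N + K * V N := hzeta ▸ ciSup_le (hbound hN)
  rw [abs_mul, Nat.abs_cast, abs_of_nonpos (by linarith)]
  calc -(zetaBetween x 0 (k ++ [a]) N - zeta x (k ++ [a])) * N
      ≤ K * V N * N := mul_le_mul_of_nonneg_right (by linarith) hN'.le
    _ = K * elemSum k.length N := by simp only [hV]; field_simp

/-- The last entry is a sum of two positive integers, so every index occurring in the star series is
admissible. -/
theorem eq_append_of_mem_circledastStar {k l w : Index} (hw : w ∈ circledastStar k l) :
    ∃ (v : Index) (a : ℕ+), w = v ++ [a] ∧ 2 ≤ (a : ℕ) := by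
  simp only [circledastStar, Multiset.mem_bind] at hw
  obtain ⟨u, _, hw⟩ := hw
  rw [circledast] at hw
  split at hw
  · obtain ⟨v, _, rfl⟩ := Multiset.mem_map.1 hw
    refine ⟨v, _, rfl, ?_⟩
    rw [PNat.add_coe]
    exact Nat.add_le_add (PNat.pos _) (PNat.pos _)
  · simp at hw

theorem small_coeff_starTrunc_sub {x : ℝ} (hx : |x| < 1) (k : Index) (m : ℕ) :
    Small fun N => PowerSeries.coeff m (starTrunc x k N - starSeries x k) := by
  have key (s : Multiset Index) (hs : ∀ w ∈ s, ∃ (v : Index) (a : ℕ+), w = v ++ [a] ∧ 2 ≤ (a : ℕ)) :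
      Small fun N => (s.map fun w => zetaTrunc x w N).sum - (s.map (zeta x)).sum := by
    induction s using Multiset.induction_on with
    | empty => exact ⟨0, 0, fun N _ => by simp⟩
    | cons w s ih =>
      obtain ⟨v, a, rfl, ha⟩ := hs w (Multiset.mem_cons_self w s)
      refine ((small_zetaTrunc_sub hx v ha).add
        (ih fun w hw => hs w (Multiset.mem_cons_of_mem hw))).congr fun N _ => ?_
      simp only [Multiset.map_cons, Multiset.sum_cons]
      ring
  refine ((slow_const ((-1) ^ m)).mul_small (key (circledastStar k (ones (m + 1)))
    fun w hw => eq_append_of_mem_circledastStar hw)).congr fun N _ => ?_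
  simp only [starTrunc, starSeries, map_sub, PowerSeries.coeff_mk, zetaSum]
  ring

end HurwitzMZV

/-! ### Taylor series and the Gamma product with a uniform rate -/

namespace HurwitzMZV

open Finset Filter

theorem taylor_mul {f g : ℝ → ℝ} (hf : AnalyticAt ℝ f 0) (hg : AnalyticAt ℝ g 0) :
    taylor (fun y => f y * g y) = taylor f * taylor g := by
  ext n
  simp only [taylor, PowerSeries.coeff_mk, PowerSeries.coeff_mul,
    iteratedDeriv_fun_mul hf.contDiffAt hg.contDiffAt, sum_div,
    Nat.sum_antidiagonal_eq_sum_range_succ_mk]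
  refine sum_congr rfl fun i hi => ?_
  rw [Nat.cast_choose _ (Nat.lt_succ_iff.1 (mem_range.1 hi))]
  field_simp [Nat.factorial_ne_zero]

theorem taylor_add {f g : ℝ → ℝ} (hf : AnalyticAt ℝ f 0) (hg : AnalyticAt ℝ g 0) :
    taylor (fun y => f y + g y) = taylor f + taylor g := by
  ext n
  simp only [taylor, PowerSeries.coeff_mk, map_add,
    iteratedDeriv_fun_add hf.contDiffAt hg.contDiffAt, add_div]

theorem taylor_congr {f g : ℝ → ℝ} (h : f =ᶠ[nhds 0] g) : taylor f = taylor g := by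
  ext n
  simp only [taylor, PowerSeries.coeff_mk]
  rw [(h.iteratedDeriv n).eq_of_nhds]

theorem taylor_const (c : ℝ) : taylor (fun _ => c) = PowerSeries.C c := by
  ext n
  simp only [taylor, PowerSeries.coeff_mk, PowerSeries.coeff_C, iteratedDeriv_const]
  split_ifs with h <;> simp [h]

theorem taylor_id : taylor (fun y => y) = PowerSeries.X := by
  ext n
  simp only [taylor, PowerSeries.coeff_mk, PowerSeries.coeff_X, iteratedDeriv_fun_id_zero]
  split_ifs with h <;> simp [h]

theorem taylor_one_add (a : ℝ) :
    taylor (fun y => 1 + a * y) = 1 + PowerSeries.C a * PowerSeries.X := by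
  rw [taylor_add (f := fun _ => 1) (g := fun y => a * y) analyticAt_const (by fun_prop),
    taylor_mul (f := fun _ => a) (g := fun y => y) analyticAt_const analyticAt_id,
    taylor_const, taylor_const, taylor_id, map_one]

theorem taylor_prod {ι : Type*} (s : Finset ι) {f : ι → ℝ → ℝ}
    (hf : ∀ i ∈ s, AnalyticAt ℝ (f i) 0) :
    taylor (fun y => ∏ i ∈ s, f i y) = ∏ i ∈ s, taylor (f i) := by
  classical
  induction s using Finset.induction_on with
  | empty => simp [taylor_const]
  | insert a s ha ih =>
    have h1 := fun i hi => hf i (mem_insert_of_mem hi)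
    simp only [prod_insert ha]
    rw [taylor_mul (hf a (mem_insert_self a s)) (s.analyticAt_fun_prod h1), ih h1]

/-- The power series `e ^ (c y)`. -/
noncomputable def expSeries (c : ℝ) : PowerSeries ℝ :=
  PowerSeries.mk fun n => c ^ n / (n.factorial : ℝ)

theorem expSeries_eq (c : ℝ) : expSeries c = PowerSeries.rescale c (PowerSeries.exp ℝ) := by
  ext n
  simp [expSeries, PowerSeries.coeff_rescale, PowerSeries.coeff_exp, div_eq_mul_inv]

theorem expSeries_add (a b : ℝ) : expSeries (a + b) = expSeries a * expSeries b := by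
  simp only [expSeries_eq, PowerSeries.exp_mul_exp_eq_exp_add]

theorem taylor_exp (c : ℝ) : taylor (fun y => Real.exp (c * y)) = expSeries c := by
  ext n
  simp [taylor, expSeries, iteratedDeriv_exp_const_mul]

/-- Iterated derivatives of a real function that extends to an entire function. -/
theorem iteratedDeriv_ofReal (n : ℕ) {g : ℂ → ℂ} {f : ℝ → ℝ} (hg : Differentiable ℂ g)
    (h : ∀ y : ℝ, g y = f y) (y : ℝ) : iteratedDeriv n g y = ((iteratedDeriv n f y : ℝ) : ℂ) := by
  induction n generalizing f g with
  | zero => simpa using h y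
  | succ n ih =>
    rw [iteratedDeriv_succ', iteratedDeriv_succ']
    refine ih hg.deriv fun z => ?_
    have h1 : HasDerivAt (fun t : ℝ => g t) (deriv g z) z := (hg z).hasDerivAt.comp_ofReal
    have h2 : HasDerivAt f (deriv g z).re z := by
      have := (hg z).hasDerivAt.real_of_complex
      simpa only [h, Complex.ofReal_re] using this
    have h3 : HasDerivAt (fun t : ℝ => g t) ((deriv g z).re : ℂ) z := by
      simpa only [h] using h2.ofReal_comp
    rw [h2.deriv]
    exact h1.unique h3

/-- A sequence whose successive quotients are `1 + O(1 / (N (N + 1)))` converges at rate `1/N`. -/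
theorem norm_sub_limit_le {F : ℕ → ℂ} {L : ℂ} {C : ℝ} (hC : 0 ≤ C) (h1 : ‖F 1‖ ≤ 1)
    (hF : ∀ N : ℕ, 0 < N → ‖F (N + 1) - F N‖ ≤ ‖F N‖ * (C / (N * (N + 1))))
    (hL : Tendsto F atTop (nhds L)) {N : ℕ} (hN : 0 < N) :
    ‖F N - L‖ ≤ C * Real.exp C / N := by
  -- The relative increments telescope: their total is at most `C`, which bounds `‖F N‖` by `exp C`,
  -- and from `N` onwards it is at most `C / N`, which gives the rate.
  have hdiff {N : ℕ} (hN : 0 < N) : C / (N * ((N : ℝ) + 1)) = C * (1 / N - 1 / (N + 1)) := by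
    have : (0 : ℝ) < N := by exact_mod_cast hN
    field_simp
    ring
  have hbd {N : ℕ} (hN : 0 < N) : ‖F N‖ ≤ Real.exp (C * (1 - 1 / N)) := by
    induction N, hN using Nat.le_induction with
    | base => simpa using h1
    | succ N hN ih =>
      have hN' : 0 < N := hN
      calc ‖F (N + 1)‖ = ‖F N + (F (N + 1) - F N)‖ := by congr 1; ring
        _ ≤ ‖F N‖ + ‖F N‖ * (C / (N * (N + 1))) := (norm_add_le _ _).trans (by gcongr; exact hF N hN)
        _ = ‖F N‖ * (C / (N * (N + 1)) + 1) := by ring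
        _ ≤ Real.exp (C * (1 - 1 / N)) * Real.exp (C / (N * (N + 1))) := by
            gcongr
            exact Real.add_one_le_exp _
        _ = _ := by
            rw [← Real.exp_add, hdiff hN']
            push_cast
            congr 1
            ring
  have hbd' {N : ℕ} (hN : 0 < N) : ‖F N‖ ≤ Real.exp C := by
    refine (hbd hN).trans (Real.exp_le_exp.2 ?_)
    have : (0 : ℝ) ≤ 1 / N := by positivity
    nlinarith
  have htel {M : ℕ} (hM : N ≤ M) :
      ‖F N - F M‖ ≤ C * Real.exp C * (1 / N - 1 / M) := by
    induction M, hM using Nat.le_induction with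
    | base => simp
    | succ M hM ih =>
      have hM' : 0 < M := hN.trans_le hM
      have h2 := hF M hM'
      have h3 : ‖F M‖ * (C / (M * (M + 1))) ≤ Real.exp C * (C / (M * (M + 1))) := by
        gcongr
        exact hbd' hM'
      calc ‖F N - F (M + 1)‖ ≤ ‖F N - F M‖ + ‖F M - F (M + 1)‖ := norm_sub_le_norm_sub_add_norm_sub _ _ _
        _ ≤ C * Real.exp C * (1 / N - 1 / M) + Real.exp C * (C / (M * (M + 1))) := by
            rw [norm_sub_rev (F M)]
            gcongr
            exact h2.trans h3
        _ = _ := by rw [hdiff hM']; push_cast; ring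
  refine le_of_tendsto (tendsto_const_nhds.sub hL).norm ?_
  filter_upwards [eventually_ge_atTop N] with M hM
  refine (htel hM).trans ?_
  have : (0 : ℝ) ≤ 1 / M := by positivity
  rw [div_eq_mul_one_div (C * Real.exp C)]
  exact mul_le_mul_of_nonneg_left (by linarith) (by positivity)

theorem log_succ_sub_log_bounds {n : ℕ} (h : 0 < n) :
    1 / ((n : ℝ) + 1) ≤ Real.log (n + 1) - Real.log n ∧
      Real.log (n + 1) - Real.log n ≤ 1 / n := by
  have hn : (0 : ℝ) < n := by exact_mod_cast h
  rw [← Real.log_div (by positivity) hn.ne']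
  constructor
  · have := Real.one_sub_inv_le_log_of_pos (x := ((n : ℝ) + 1) / n) (by positivity)
    refine le_trans (le_of_eq ?_) this
    field_simp
    ring
  · have := Real.log_le_sub_one_of_pos (x := ((n : ℝ) + 1) / n) (by positivity)
    refine this.trans (le_of_eq ?_)
    field_simp
    ring

/-- The normalized product `N ^ (-z) ∏ (1 + z / (n + x))`. -/
noncomputable def normProd (x : ℝ) (N : ℕ) (z : ℂ) : ℂ :=
  Complex.exp (-(Real.log N : ℂ) * z) * ∏ n ∈ Ioo 0 N, (1 + (factor x 1 n : ℂ) * z)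

theorem normProd_succ (x : ℝ) {N : ℕ} (h : 0 < N) (z : ℂ) :
    normProd x (N + 1) z = normProd x N z * ((1 + (factor x 1 N : ℂ) * z) *
      Complex.exp (-((Real.log (N + 1) - Real.log N : ℝ) : ℂ) * z)) := by
  rw [normProd, normProd, Ioo_zero_succ h, prod_insert (by simp)]
  have : Complex.exp (-(Real.log (N + 1 : ℕ) : ℂ) * z) = Complex.exp (-(Real.log N : ℂ) * z) *
      Complex.exp (-((Real.log (N + 1) - Real.log N : ℝ) : ℂ) * z) := by
    rw [← Complex.exp_add]
    congr 1
    push_cast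
    ring
  rw [this]
  ring

/-- Both `1/(n+x)` and `log(n+1) - log n` are `1/n + O(1/n²)`, so the terms linear in `z` cancel to
second order. The bound is stated with `n(n+1)` so that it telescopes in `norm_sub_limit_le`. -/
theorem norm_step_sub_one_le {x : ℝ} (hx : |x| < 1) {n : ℕ} (hn : 0 < n) {z : ℂ} (hz : ‖z‖ ≤ 1) :
    ‖(1 + (factor x 1 n : ℂ) * z) * Complex.exp (-((Real.log (n + 1) - Real.log n : ℝ) : ℂ) * z)
      - 1‖ ≤ 2 * (2 + 3 * (1 / (1 - |x|))) / (n * (n + 1)) := by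
  have h1 : (1 : ℝ) ≤ n := by exact_mod_cast hn
  have h2 : 0 < 1 - |x| := by linarith
  set A := 1 / (1 - |x|) with hA
  have hA0 : 0 < A := by positivity
  set a := factor x 1 n with ha
  obtain ⟨hl1, hl2⟩ := log_succ_sub_log_bounds hn
  set l := Real.log (n + 1) - Real.log n with hl
  have ha0 : 0 ≤ a := factor_nonneg hx 1 hn
  have ha1 : a ≤ A * (1 / n) := by simpa [hA] using factor_le hx 1 hn
  have hl0 : 0 ≤ l := le_trans (by positivity) hl1
  set v : ℝ := 1 / n with hv
  have hv0 : 0 ≤ v := by positivity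
  have hv1 : v ≤ 1 := by rw [hv, div_le_one (by linarith)]; exact h1
  have hav : |a - v| ≤ A * v ^ 2 := by
    have h3 : 0 < (n : ℝ) + x := by linarith [(abs_lt.1 hx).1]
    have : a - v = -x * (a * v) := by
      simp only [ha, hv, factor, PNat.one_coe, pow_one]
      field_simp
      ring
    rw [this, abs_mul, abs_neg, abs_of_nonneg (mul_nonneg ha0 hv0)]
    calc |x| * (a * v) ≤ 1 * (A * v * v) := by gcongr
      _ = _ := by ring
  have hlv : |v - l| ≤ v ^ 2 := by
    rw [abs_of_nonneg (by linarith)]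
    have : v - 1 / (n + 1) ≤ v ^ 2 := by
      rw [hv, div_sub_div _ _ (by positivity) (by positivity), div_pow,
        div_le_div_iff₀ (by positivity) (by positivity)]
      nlinarith
    linarith
  have hal : |a - l| ≤ (A + 1) * v ^ 2 := by
    calc |a - l| ≤ |a - v| + |v - l| := abs_sub_le _ _ _
      _ ≤ _ := by linarith
  have hw : ‖-(l : ℂ) * z‖ ≤ l := by
    rw [norm_mul, norm_neg, Complex.norm_real, Real.norm_of_nonneg hl0]
    exact mul_le_of_le_one_right hl0 hz
  have hexp := Complex.norm_exp_sub_one_sub_id_le (hw.trans (hl2.trans hv1))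
  have haz : ‖1 + (a : ℂ) * z‖ ≤ 1 + A := by
    refine (norm_add_le _ _).trans ?_
    rw [norm_one, norm_mul, Complex.norm_real, Real.norm_of_nonneg ha0]
    have : a * ‖z‖ ≤ A * 1 * 1 := by
      refine mul_le_mul (ha1.trans ?_) hz (norm_nonneg _) (by positivity)
      gcongr
    linarith
  have hid : (1 + (a : ℂ) * z) * Complex.exp (-(l : ℂ) * z) - 1 =
      (1 + (a : ℂ) * z) * (Complex.exp (-(l : ℂ) * z) - 1 - -(l : ℂ) * z)
        + ((a - l : ℝ) : ℂ) * z + -((a * l : ℝ) : ℂ) * z ^ 2 := by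
    push_cast
    ring
  rw [hid]
  have e1 : ‖(1 + (a : ℂ) * z) * (Complex.exp (-(l : ℂ) * z) - 1 - -(l : ℂ) * z)‖ ≤
      (1 + A) * v ^ 2 := by
    rw [norm_mul]
    refine mul_le_mul haz (hexp.trans ?_) (norm_nonneg _) (by positivity)
    exact pow_le_pow_left₀ (norm_nonneg _) (hw.trans hl2) 2
  have e2 : ‖((a - l : ℝ) : ℂ) * z‖ ≤ (A + 1) * v ^ 2 := by
    rw [norm_mul, Complex.norm_real, Real.norm_eq_abs]
    exact (mul_le_of_le_one_right (abs_nonneg _) hz).trans hal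
  have e3 : ‖-((a * l : ℝ) : ℂ) * z ^ 2‖ ≤ A * v ^ 2 := by
    rw [norm_mul, norm_neg, Complex.norm_real, Real.norm_of_nonneg (mul_nonneg ha0 hl0), norm_pow]
    calc a * l * ‖z‖ ^ 2 ≤ A * v * v * 1 := by
          gcongr
          exact pow_le_one₀ (norm_nonneg _) hz
      _ = _ := by ring
  have e4 : v ^ 2 ≤ 2 / (n * (n + 1)) := by
    rw [hv, div_pow, one_pow, div_le_div_iff₀ (by positivity) (by positivity)]
    nlinarith
  calc _ ≤ (1 + A) * v ^ 2 + (A + 1) * v ^ 2 + A * v ^ 2 :=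
        (norm_add₃_le).trans (add_le_add (add_le_add e1 e2) e3)
    _ = (2 + 3 * A) * v ^ 2 := by ring
    _ ≤ (2 + 3 * A) * (2 / (n * (n + 1))) := by gcongr
    _ = _ := by ring

theorem tendsto_log_add_two_sub_log :
    Tendsto (fun n : ℕ => Real.log ((n + 2 : ℕ) : ℝ) - Real.log n) atTop (nhds 0) := by
  have h1 := Real.tendsto_log_nat_add_one_sub_log
  have h2 := (tendsto_add_atTop_iff_nat 1).2 h1
  have := h2.add h1
  rw [add_zero] at this
  refine this.congr fun n => ?_
  push_cast
  rw [show (n : ℝ) + 1 + 1 = n + 2 by ring]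
  ring

/-- A quotient of two instances of Gauss's limit for `Γ`. The radius keeps the real part of `1 + x +
z` positive, away from the poles. -/
theorem tendsto_normProd {x : ℝ} (hx : |x| < 1) {z : ℂ} (hz : ‖z‖ ≤ (1 - |x|) / 2) :
    Tendsto (fun N => normProd x N z) atTop
      (nhds (Complex.Gamma (1 + x) * (Complex.Gamma (1 + x + z))⁻¹)) := by
  have hx1 := (abs_lt.1 hx).1
  have hx2 := neg_abs_le x
  have hzr := (abs_le.1 (Complex.abs_re_le_norm z)).1
  have hre1 : 0 < ((1 : ℂ) + x).re := by simp; linarith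
  have hre2 : 0 < ((1 : ℂ) + x + z).re := by simp; linarith
  have hne {s : ℂ} (hs : 0 < s.re) (j : ℕ) : s + j ≠ 0 := by
    intro h
    have := congrArg Complex.re h
    simp at this
    have : (0 : ℝ) ≤ j := Nat.cast_nonneg j
    linarith
  -- `GammaSeq` at `n` has `n + 1` factors, as has the product over `0 < i < n + 2`; but it is
  -- scaled by a power of `n` instead of `n + 2`, hence the correction `log(n+2) - log n`, which
  -- tends to `0`.
  rw [← tendsto_add_atTop_iff_nat 2]
  have hlim : Tendsto (fun n : ℕ => Complex.exp (-((Real.log ((n + 2 : ℕ) : ℝ) - Real.log n : ℝ) : ℂ) * z)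
      * (Complex.GammaSeq (1 + x) n * (Complex.GammaSeq (1 + x + z) n)⁻¹)) atTop
      (nhds (1 * (Complex.Gamma (1 + x) * (Complex.Gamma (1 + x + z))⁻¹))) := by
    refine Tendsto.mul ?_ ((Complex.GammaSeq_tendsto_Gamma _).mul
      ((Complex.GammaSeq_tendsto_Gamma _).inv₀ (Complex.Gamma_ne_zero_of_re_pos hre2)))
    have h := (Complex.continuous_ofReal.tendsto 0).comp tendsto_log_add_two_sub_log
    have := (Complex.continuous_exp.tendsto _).comp (h.neg.mul_const z)
    simpa [Function.comp_def] using this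
  rw [one_mul] at hlim
  refine hlim.congr' ?_
  filter_upwards [eventually_gt_atTop 0] with n hn
  have hn' : (n : ℂ) ≠ 0 := by exact_mod_cast hn.ne'
  have hprod : ∏ i ∈ Ioo 0 (n + 2), (1 + (factor x 1 i : ℂ) * z) =
      (∏ j ∈ range (n + 1), (1 + x + z + j)) / ∏ j ∈ range (n + 1), ((1 : ℂ) + x + j) := by
    rw [← prod_div_distrib, show Ioo 0 (n + 2) = (range (n + 1)).image (· + 1) by
      ext i
      simp only [mem_Ioo, mem_image, mem_range]
      exact ⟨fun h => ⟨i - 1, by omega, by omega⟩, by rintro ⟨j, h, rfl⟩; omega⟩,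
      prod_image (by simp)]
    refine prod_congr rfl fun j _ => ?_
    have := hne hre1 j
    simp only [factor, PNat.one_coe, pow_one]
    push_cast
    rw [show (j : ℂ) + 1 + x = 1 + x + j by ring]
    field_simp
    ring
  have hp1 : ∏ j ∈ range (n + 1), ((1 : ℂ) + x + j) ≠ 0 := prod_ne_zero_iff.2 fun j _ => hne hre1 j
  have hp2 : ∏ j ∈ range (n + 1), ((1 : ℂ) + x + z + j) ≠ 0 :=
    prod_ne_zero_iff.2 fun j _ => hne hre2 j
  have hfac : (n.factorial : ℂ) ≠ 0 := by exact_mod_cast n.factorial_ne_zero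
  have hpow : (n : ℂ) ^ (1 + x + z) = (n : ℂ) ^ ((1 : ℂ) + x) * Complex.exp (Real.log n * z) := by
    rw [Complex.cpow_add _ _ hn', Complex.cpow_def_of_ne_zero hn' z, Complex.natCast_log]
  have hpow1 : (n : ℂ) ^ ((1 : ℂ) + x) ≠ 0 := by simp [Complex.cpow_eq_zero_iff, hn']
  have hexp : Complex.exp (-((Real.log ((n + 2 : ℕ) : ℝ) - Real.log n : ℝ) : ℂ) * z) =
      Complex.exp (-(Real.log ((n + 2 : ℕ) : ℝ) : ℂ) * z) * Complex.exp (Real.log n * z) := by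
    rw [← Complex.exp_add]
    congr 1
    push_cast
    ring
  rw [normProd, hprod, Complex.GammaSeq, Complex.GammaSeq, hpow, hexp]
  have := Complex.exp_ne_zero (Real.log n * z)
  field_simp

theorem norm_normProd_sub_le {x : ℝ} (hx : |x| < 1) :
    ∃ C : ℝ, ∀ (z : ℂ) (N : ℕ), ‖z‖ ≤ (1 - |x|) / 2 → 0 < N →
      ‖normProd x N z - Complex.Gamma (1 + x) * (Complex.Gamma (1 + x + z))⁻¹‖ ≤ C / N := by
  have h2 : 0 < 1 - |x| := by linarith
  refine ⟨_, fun z N hz hN => norm_sub_limit_le (C := 2 * (2 + 3 * (1 / (1 - |x|))))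
    (by positivity) ?_ (fun N hN => ?_) (tendsto_normProd hx hz) hN⟩
  · rw [normProd, show Ioo 0 1 = ∅ by ext i; simp; omega]
    simp
  · rw [normProd_succ x hN, ← mul_sub_one, norm_mul]
    refine mul_le_mul_of_nonneg_left (norm_step_sub_one_le hx hN ?_) (norm_nonneg _)
    have := abs_nonneg x
    linarith

/-- The quotient `Γ(1 + x) / Γ(1 + x + y)`. -/
noncomputable def gammaQuot (x y : ℝ) : ℝ := Real.Gamma (1 + x) / Real.Gamma (1 + x + y)

/-- `1/Γ` is entire: the value `0` assigned to `Γ` at its poles has inverse `0`, the correct value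
there. -/
theorem differentiable_gammaQuot (x : ℝ) : Differentiable ℂ fun z : ℂ =>
    Complex.Gamma (1 + x) * (Complex.Gamma (1 + x + z))⁻¹ :=
  (Complex.differentiable_one_div_Gamma.comp (differentiable_id.const_add _)).const_mul _

theorem gammaQuot_ofReal (x y : ℝ) :
    Complex.Gamma (1 + x) * (Complex.Gamma (1 + x + y))⁻¹ = (gammaQuot x y : ℂ) := by
  rw [gammaQuot, div_eq_mul_inv]
  push_cast [← Complex.Gamma_ofReal]
  rfl

theorem analyticAt_gammaQuot (x y : ℝ) : AnalyticAt ℝ (gammaQuot x) y := by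
  have := ((differentiable_gammaQuot x).analyticAt y).re_ofReal
  simpa only [gammaQuot_ofReal, Complex.ofReal_re] using this

theorem analyticAt_exp_mul (c : ℝ) (y : ℝ) : AnalyticAt ℝ (fun y => Real.exp (c * y)) y := by
  fun_prop

theorem analyticAt_onesProd (x : ℝ) (N : ℕ) (y : ℝ) :
    AnalyticAt ℝ (fun y => ∏ n ∈ Ioo 0 N, (1 + factor x 1 n * y)) y :=
  Finset.analyticAt_fun_prod _ fun n _ => by fun_prop

/-- The generating polynomial is `e ^ (y log N) Γ(1 + x) / Γ(1 + x + y)`, up to small errors. -/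
theorem small_coeff_onesSeries_sub {x : ℝ} (hx : |x| < 1) (m : ℕ) :
    Small fun N => PowerSeries.coeff m
      (onesSeries x N - expSeries (Real.log N) * taylor (gammaQuot x)) := by
  have h2 : 0 < (1 - |x|) / 2 := by linarith
  obtain ⟨C, hC⟩ := norm_normProd_sub_le hx
  let d : ℕ → ℝ → ℝ := fun N y =>
    Real.exp (-Real.log N * y) * ∏ n ∈ Ioo 0 N, (1 + factor x 1 n * y) + -1 * gammaQuot x y
  have hda (N : ℕ) : AnalyticAt ℝ (d N) 0 :=
    ((analyticAt_exp_mul _ _).mul (analyticAt_onesProd x N 0)).add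
      (analyticAt_const.mul (analyticAt_gammaQuot x 0))
  have hd (m : ℕ) : Small fun N => PowerSeries.coeff m (taylor (d N)) := by
    refine ⟨C / ((1 - |x|) / 2) ^ m, 0, fun N hN => ?_⟩
    let D : ℂ → ℂ := fun z =>
      normProd x N z - Complex.Gamma (1 + x) * (Complex.Gamma (1 + x + z))⁻¹
    have hD : Differentiable ℂ D := by
      refine Differentiable.sub ?_ (differentiable_gammaQuot x)
      refine (Complex.differentiable_exp.comp (differentiable_id.const_mul _)).mul ?_
      exact Differentiable.fun_finsetProd fun n _ => by fun_prop
    have hDd (y : ℝ) : D y = d N y := by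
      simp only [D, d, gammaQuot_ofReal, normProd]
      push_cast
      ring
    -- Cauchy's estimate on the circle of radius `(1 - |x|) / 2` turns the uniform `O(1/N)` bound
    -- into the same rate for each Taylor coefficient.
    have hcauchy := Complex.norm_iteratedDeriv_le_of_forall_mem_sphere_norm_le (c := 0) m h2
      hD.diffContOnCl fun z hz => hC z N (mem_sphere_zero_iff_norm.1 hz).le hN
    have hre := iteratedDeriv_ofReal m hD hDd 0
    rw [Complex.ofReal_zero] at hre
    rw [hre, Complex.norm_real, Real.norm_eq_abs] at hcauchy
    have hm : (0 : ℝ) < m.factorial := by exact_mod_cast m.factorial_pos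
    have hcoeff : PowerSeries.coeff m (taylor (d N)) = iteratedDeriv m (d N) 0 / m.factorial :=
      PowerSeries.coeff_mk _ _
    change |PowerSeries.coeff m (taylor (d N))| ≤ _
    rw [hcoeff, abs_div, Nat.abs_cast, div_le_iff₀ hm]
    refine hcauchy.trans (le_of_eq ?_)
    rw [pow_zero]
    ring
  -- Undoing the normalization multiplies by `e^(y log N)`, whose coefficients are powers of `log N`
  -- up to constants; this preserves smallness.
  have hid (N : ℕ) : onesSeries x N - expSeries (Real.log N) * taylor (gammaQuot x) =
      expSeries (Real.log N) * taylor (d N) := by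
    have e1 : onesSeries x N = taylor fun y => ∏ n ∈ Ioo 0 N, (1 + factor x 1 n * y) := by
      rw [taylor_prod _ fun n _ => by fun_prop]
      exact prod_congr rfl fun n _ => (taylor_one_add _).symm
    have e2 : taylor (d N) = expSeries (-Real.log N) * onesSeries x N +
        PowerSeries.C (-1) * taylor (gammaQuot x) := by
      have h1 := taylor_mul (analyticAt_exp_mul (-Real.log N) 0) (analyticAt_onesProd x N 0)
      have h2 := taylor_mul (f := fun _ => -1) analyticAt_const (analyticAt_gammaQuot x 0)
      rw [e1, ← taylor_exp, ← h1, ← taylor_const, ← h2]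
      exact taylor_add ((analyticAt_exp_mul _ _).mul (analyticAt_onesProd x N 0))
        (analyticAt_const.mul (analyticAt_gammaQuot x 0))
    have e3 : expSeries (Real.log N) * expSeries (-Real.log N) = 1 := by
      rw [← expSeries_add, add_neg_cancel, ← taylor_exp]
      simp [taylor_const]
    rw [e2, mul_add, ← mul_assoc, e3, one_mul, map_neg, map_one]
    ring
  simp only [hid, PowerSeries.coeff_mul]
  refine Small.sum _ fun p _ => Slow.mul_small ?_ (hd p.2)
  simp only [expSeries, PowerSeries.coeff_mk, div_eq_mul_inv]
  exact (slow_log.pow _).mul (slow_const _)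

end HurwitzMZV

/-! ### Abel means and the transfer to polylogarithms -/

namespace HurwitzMZV

open Finset Filter Asymptotics Topology

theorem Slow.summable {f : ℕ → ℝ} (hf : Slow f) {t : ℝ} (ht : |t| < 1) :
    Summable fun n => t ^ n * f (n + 1) := by
  obtain ⟨C, p, hC⟩ := hf
  have h1 := (summable_pow_mul_geometric_of_norm_lt_one (R := ℝ) p (r := |t|) (by simpa using ht))
  have h2 := (summable_geometric_of_abs_lt_one (r := |t|) (by simpa using ht))
  refine Summable.of_norm_bounded (((h1.add h2).mul_left (2 ^ p)).mul_left |C|) fun n => ?_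
  rw [Real.norm_eq_abs, abs_mul, abs_pow]
  have h3 : logScale (n + 1) ≤ n + 1 := by
    have := Real.log_le_sub_one_of_pos (x := ((n + 1 : ℕ) : ℝ)) (by positivity)
    simp only [logScale]
    push_cast at this ⊢
    linarith
  have h4 : ((n : ℝ) + 1) ^ p ≤ 2 ^ p * (n ^ p + 1) := by
    rcases Nat.eq_zero_or_pos n with rfl | hn
    · have h5 : (1 : ℝ) ≤ 2 ^ p := one_le_pow₀ (by norm_num)
      have h6 : (0 : ℝ) ≤ ((0 : ℕ) : ℝ) ^ p := by positivity
      rw [Nat.cast_zero, zero_add, one_pow] at *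
      nlinarith
    · have : (1 : ℝ) ≤ n := by exact_mod_cast hn
      calc ((n : ℝ) + 1) ^ p ≤ (2 * n) ^ p := by gcongr; linarith
        _ = 2 ^ p * n ^ p := mul_pow _ _ _
        _ ≤ 2 ^ p * (n ^ p + 1) := by gcongr; linarith
  have h0 : (0 : ℝ) ≤ logScale (n + 1) := zero_le_one.trans (one_le_logScale _)
  calc |t| ^ n * |f (n + 1)| ≤ |t| ^ n * (|C| * (2 ^ p * (n ^ p + 1))) := by
        gcongr
        refine (hC (n + 1) (Nat.succ_pos n)).trans ?_
        refine mul_le_mul (le_abs_self C) ?_ (by positivity) (abs_nonneg C)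
        exact (pow_le_pow_left₀ h0 h3 p).trans h4
    _ = _ := by ring

/-- The Abel mean `(1 - t) ∑ t ^ (N - 1) f(N)`. -/
noncomputable def abelMean (f : ℕ → ℝ) (t : ℝ) : ℝ := (1 - t) * ∑' n, t ^ n * f (n + 1)

/-- Summation by parts; `f 1 = 0` removes the boundary term. -/
theorem hasSum_abelMean {f : ℕ → ℝ} (hf : Slow f) (h1 : f 1 = 0) {t : ℝ} (ht : |t| < 1) :
    HasSum (fun n => t ^ (n + 1) * (f (n + 2) - f (n + 1))) (abelMean f t) := by
  have hs := (hf.summable ht).hasSum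
  have hs1 := (hasSum_nat_add_iff' 1).2 hs
  have hs2 := hs.mul_left t
  have := hs1.sub hs2
  simp only [sum_range_one, pow_zero, one_mul, zero_add, h1, sub_zero] at this
  rw [← one_sub_mul] at this
  refine this.congr_fun fun n => ?_
  rw [pow_succ]
  ring

theorem abelMean_add {f g : ℕ → ℝ} (hf : Slow f) (hg : Slow g) {t : ℝ} (ht : |t| < 1) :
    abelMean (fun N => f N + g N) t = abelMean f t + abelMean g t := by
  simp only [abelMean, mul_add, (hf.summable ht).tsum_add (hg.summable ht)]

theorem abelMean_const_mul (c : ℝ) (f : ℕ → ℝ) (t : ℝ) :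
    abelMean (fun N => c * f N) t = c * abelMean f t := by
  simp only [abelMean, mul_left_comm _ c, tsum_mul_left]

theorem abelMean_sum {ι : Type*} (s : Finset ι) {f : ι → ℕ → ℝ} (hf : ∀ i ∈ s, Slow (f i)) {t : ℝ}
    (ht : |t| < 1) : abelMean (fun N => ∑ i ∈ s, f i N) t = ∑ i ∈ s, abelMean (f i) t := by
  simp only [abelMean, mul_sum]
  rw [Summable.tsum_finsetSum fun i hi => (hf i hi).summable ht, mul_sum]

theorem slow_elem_div (i : ℕ) : Slow fun N => elem i N / N := by
  refine (slow_elem i).of_le fun N hN => ?_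
  have : (1 : ℝ) ≤ N := by exact_mod_cast hN
  rw [abs_of_nonneg (div_nonneg (elem_nonneg i N) (by linarith))]
  exact div_le_self (elem_nonneg i N) this

theorem abelMean_elem_succ (i : ℕ) {t : ℝ} (ht : |t| < 1) :
    abelMean (elem (i + 1)) t = ∑' n : ℕ, t ^ (n + 1) * (elem i (n + 1) / ((n : ℝ) + 1)) := by
  rw [← (hasSum_abelMean (slow_elem (i + 1)) (elem_succ_one i) ht).tsum_eq]
  refine tsum_congr fun n => ?_
  rw [elem_succ_succ i (Nat.succ_pos n), add_sub_cancel_left]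
  push_cast
  rw [one_div_mul_eq_div]

/-- The polylogarithm of index `(1, …, 1)` at `x = 0` is a power of the logarithm. -/
theorem abelMean_elem (i : ℕ) {t : ℝ} (ht : |t| < 1) :
    abelMean (elem i) t = (-Real.log (1 - t)) ^ i / (i.factorial : ℝ) := by
  induction i generalizing t with
  | zero =>
    have h : 1 - t ≠ 0 := by linarith [(abs_lt.1 ht).2]
    simp only [abelMean, elem_zero, mul_one, tsum_geometric_of_abs_lt_one ht, pow_zero,
      Nat.factorial_zero, Nat.cast_one, div_one]
    exact mul_inv_cancel₀ h
  | succ i ih =>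
    rw [abelMean_elem_succ i ht]
    set s : Set ℝ := Set.Ioo (-1) 1 with hs
    have hmem {u : ℝ} : u ∈ s ↔ |u| < 1 := by rw [abs_lt]; rfl
    -- Termwise differentiation, dominated at a radius `r` with `|u| < r < 1`, gives `abelMean (elem
    -- i) u / (1 - u)`. By the inductive hypothesis this is also the derivative of the power of the
    -- logarithm, and both sides vanish at `0`.
    have hderiv {u : ℝ} (hu : u ∈ s) : HasDerivAt
        (fun u : ℝ => ∑' n : ℕ, u ^ (n + 1) * (elem i (n + 1) / ((n : ℝ) + 1)))
        (∑' n : ℕ, u ^ n * elem i (n + 1)) u := by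
      obtain ⟨r, hr1, hr2⟩ := exists_between (hmem.1 hu)
      have hr0 : 0 ≤ r := (abs_nonneg u).trans hr1.le
      have hmaj := (slow_elem i).summable (t := r) (by rwa [abs_of_nonneg hr0])
      refine hasDerivAt_tsum_of_isPreconnected (t := Set.Ioo (-r) r) (y₀ := (0 : ℝ))
        (g := fun (n : ℕ) (u : ℝ) => u ^ (n + 1) * (elem i (n + 1) / ((n : ℝ) + 1)))
        (g' := fun (n : ℕ) (u : ℝ) => u ^ n * elem i (n + 1)) hmaj isOpen_Ioo
        isPreconnected_Ioo (fun n y _ => ?_) (fun n y hy => ?_) ?_ ?_ ?_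
      · have h := (hasDerivAt_pow (n + 1) y).mul_const (elem i (n + 1) / ((n : ℝ) + 1))
        refine h.congr_deriv ?_
        have : (n : ℝ) + 1 ≠ 0 := by positivity
        push_cast
        field_simp
      · rw [norm_mul, norm_pow, Real.norm_of_nonneg (elem_nonneg _ _), Real.norm_eq_abs]
        exact mul_le_mul_of_nonneg_right
          (pow_le_pow_left₀ (abs_nonneg y) (abs_lt.2 hy).le n) (elem_nonneg _ _)
      · have := (abs_nonneg u).trans_lt hr1
        constructor <;> linarith
      · simp
      · exact abs_lt.1 hr1
    have hderiv' {u : ℝ} (hu : u ∈ s) : HasDerivAt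
        (fun u : ℝ => (-Real.log (1 - u)) ^ (i + 1) / ((i + 1).factorial : ℝ))
        (∑' n : ℕ, u ^ n * elem i (n + 1)) u := by
      have h1 : 0 < 1 - u := by linarith [hu.2]
      have h2 : HasDerivAt (fun u : ℝ => -Real.log (1 - u)) (1 / (1 - u)) u := by
        have := (((hasDerivAt_id u).const_sub 1).log h1.ne').neg
        refine this.congr_deriv ?_
        simp only [id]
        ring
      refine ((h2.fun_pow (i + 1)).div_const _).congr_deriv ?_
      have h3 := ih (hmem.1 hu)
      rw [abelMean] at h3
      have h4 : ∑' n : ℕ, u ^ n * elem i (n + 1) =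
          (-Real.log (1 - u)) ^ i / (i.factorial : ℝ) / (1 - u) := by
        rw [← h3]
        field_simp
      rw [h4, Nat.factorial_succ, Nat.add_sub_cancel]
      push_cast
      have : (i.factorial : ℝ) ≠ 0 := by exact_mod_cast i.factorial_ne_zero
      field_simp
    refine isOpen_Ioo.eqOn_of_deriv_eq (s := s) isPreconnected_Ioo
      (fun u hu => (hderiv hu).differentiableAt.differentiableWithinAt)
      (fun u hu => (hderiv' hu).differentiableAt.differentiableWithinAt)
      (fun u hu => (hderiv hu).deriv.trans (hderiv' hu).deriv.symm)
      (x := 0) (hmem.2 (by simp)) ?_ (hmem.2 ht)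
    simp

/-- `f(t)` is `O((1 - t) log ^ p (1 - t))` as `t → 1` from below, for some `p`. -/
def SmallAtOne (f : ℝ → ℝ) : Prop :=
  ∃ p : ℕ, f =O[𝓝[<] 1] fun t : ℝ => (1 - t) * Real.log (1 - t) ^ p

theorem tendsto_one_sub : Tendsto (fun t : ℝ => 1 - t) (𝓝[<] 1) (𝓝[>] 0) := by
  refine tendsto_nhdsWithin_iff.2 ⟨?_, ?_⟩
  · have : Tendsto (fun t : ℝ => 1 - t) (𝓝 1) (𝓝 (1 - 1)) := tendsto_const_nhds.sub tendsto_id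
    rw [sub_self] at this
    exact this.mono_left nhdsWithin_le_nhds
  · filter_upwards [self_mem_nhdsWithin] with t ht
    exact Set.mem_Ioi.2 (sub_pos.2 (Set.mem_Iio.1 ht))

theorem tendsto_neg_log_one_sub : Tendsto (fun t : ℝ => -Real.log (1 - t)) (𝓝[<] 1) atTop :=
  tendsto_neg_atBot_atTop.comp (Real.tendsto_log_nhdsGT_zero.comp tendsto_one_sub)

theorem log_pow_isBigO {p q : ℕ} (h : p ≤ q) :
    (fun t : ℝ => Real.log (1 - t) ^ p) =O[𝓝[<] 1] fun t : ℝ => Real.log (1 - t) ^ q := by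
  refine IsBigO.of_bound 1 ?_
  filter_upwards [tendsto_neg_log_one_sub.eventually_ge_atTop 1] with t ht
  rw [one_mul, norm_pow, norm_pow, Real.norm_eq_abs]
  exact pow_le_pow_right₀ (ht.trans (neg_le_abs _)) h

theorem SmallAtOne.of_le {f : ℝ → ℝ} {p q : ℕ} (h : p ≤ q)
    (hf : f =O[𝓝[<] 1] fun t : ℝ => (1 - t) * Real.log (1 - t) ^ p) :
    f =O[𝓝[<] 1] fun t : ℝ => (1 - t) * Real.log (1 - t) ^ q :=
  hf.trans ((isBigO_refl _ _).mul (log_pow_isBigO h))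

theorem SmallAtOne.add {f g : ℝ → ℝ} (hf : SmallAtOne f) (hg : SmallAtOne g) :
    SmallAtOne fun t => f t + g t := by
  obtain ⟨p, hp⟩ := hf
  obtain ⟨q, hq⟩ := hg
  exact ⟨p + q, (SmallAtOne.of_le (Nat.le_add_right p q) hp).add
    (SmallAtOne.of_le (Nat.le_add_left q p) hq)⟩

theorem SmallAtOne.sum {ι : Type*} (s : Finset ι) {f : ι → ℝ → ℝ} (h : ∀ i ∈ s, SmallAtOne (f i)) :
    SmallAtOne fun t => ∑ i ∈ s, f i t := by
  classical
  induction s using Finset.induction_on with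
  | empty => exact ⟨0, by simpa using isBigO_zero _ _⟩
  | insert a s ha ih =>
    simp only [sum_insert ha]
    exact (h a (mem_insert_self a s)).add (ih fun i hi => h i (mem_insert_of_mem hi))

theorem SmallAtOne.bounded_mul {f g : ℝ → ℝ} (hf : f =O[𝓝[<] 1] fun _ => (1 : ℝ))
    (hg : SmallAtOne g) : SmallAtOne fun t => f t * g t := by
  obtain ⟨p, hp⟩ := hg
  exact ⟨p, by simpa using hf.mul hp⟩

/-- `|f N|` is dominated by a constant times `∑ elem i N / N`, and the power series of `elem i N /
N` is the Abel mean of `elem (i + 1)` divided by `t`, a power of the logarithm; the factor `1 - t`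
remains. -/
theorem small_abelMean {f : ℕ → ℝ} (hf : Small f) : SmallAtOne (abelMean f) := by
  obtain ⟨C, p, hC⟩ := hf
  obtain ⟨D, hD0, hD⟩ := logScale_pow_le_elemSum p
  have hterm (i : ℕ) : SmallAtOne fun t => |C| * D *
      (2 * ((1 - t) * ((-Real.log (1 - t)) ^ (i + 1) / ((i + 1).factorial : ℝ)))) := by
    refine ⟨i + 1, ?_⟩
    refine IsBigO.const_mul_left (IsBigO.const_mul_left ((isBigO_refl _ _).mul ?_) _) _
    simp only [div_eq_inv_mul]
    refine IsBigO.const_mul_left ?_ _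
    refine IsBigO.of_bound 1 (Eventually.of_forall fun t => ?_)
    simp
  obtain ⟨q, hq⟩ := SmallAtOne.sum (range (p + 1)) fun i _ => hterm i
  refine ⟨q, IsBigO.trans (IsBigO.of_bound 1 ?_) hq⟩
  -- Away from `0` the division by `t` costs at most the factor `2` in `hterm`.
  have hhalf : ∀ᶠ t : ℝ in 𝓝[<] 1, t ∈ Set.Ioo (1 / 2 : ℝ) 1 :=
    Ioo_mem_nhdsLT (by norm_num)
  filter_upwards [hhalf] with t ht
  have ht0 : 0 < t := by linarith [ht.1]
  have ht1 : 0 < 1 - t := by linarith [ht.2]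
  have htabs : |t| < 1 := by rw [abs_of_pos ht0]; exact ht.2
  have hsum (i : ℕ) : Summable fun n : ℕ => t ^ n * (elem i (n + 1) / ((n : ℝ) + 1)) := by
    simpa using (slow_elem_div i).summable htabs
  have hterm_le (n : ℕ) : |t ^ n * f (n + 1)| ≤
      |C| * D * ∑ i ∈ range (p + 1), t ^ n * (elem i (n + 1) / ((n : ℝ) + 1)) := by
    rw [abs_mul, abs_of_nonneg (pow_nonneg ht0.le n), ← mul_sum, ← sum_div]
    have h1 := hC (n + 1) (Nat.succ_pos n)
    have h2 := hD (n + 1) (Nat.succ_pos n)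
    have h3 : (0 : ℝ) ≤ logScale (n + 1) ^ p :=
      pow_nonneg (zero_le_one.trans (one_le_logScale _)) p
    calc t ^ n * |f (n + 1)| ≤ t ^ n * (|C| * (D * elemSum p (n + 1)) / ((n + 1 : ℕ) : ℝ)) := by
          gcongr
          refine h1.trans ?_
          gcongr
          exact le_abs_self C
      _ = _ := by rw [elemSum]; push_cast; ring
  have hsum' : Summable fun n : ℕ => |C| * D *
      ∑ i ∈ range (p + 1), t ^ n * (elem i (n + 1) / ((n : ℝ) + 1)) :=
    (summable_sum fun i _ => hsum i).mul_left _
  have hle := tsum_of_norm_bounded hsum'.hasSum fun n => (Real.norm_eq_abs _).trans_le (hterm_le n)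
  rw [tsum_mul_left, Summable.tsum_finsetSum fun i _ => hsum i] at hle
  have hval (i : ℕ) : ∑' n : ℕ, t ^ n * (elem i (n + 1) / ((n : ℝ) + 1)) ≤
      2 * ((-Real.log (1 - t)) ^ (i + 1) / ((i + 1).factorial : ℝ)) := by
    rw [← abelMean_elem (i + 1) htabs, abelMean_elem_succ i htabs]
    simp only [pow_succ', mul_assoc]
    rw [tsum_mul_left]
    have : 0 ≤ ∑' n : ℕ, t ^ n * (elem i (n + 1) / ((n : ℝ) + 1)) :=
      tsum_nonneg fun n => mul_nonneg (pow_nonneg ht0.le n)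
        (div_nonneg (elem_nonneg _ _) (by positivity))
    nlinarith [ht.1]
  rw [one_mul, abelMean, norm_mul, Real.norm_of_nonneg ht1.le]
  refine le_trans ?_ (Real.le_norm_self _)
  calc (1 - t) * ‖∑' n, t ^ n * f (n + 1)‖
      ≤ (1 - t) * (|C| * D * ∑ i ∈ range (p + 1),
          2 * ((-Real.log (1 - t)) ^ (i + 1) / ((i + 1).factorial : ℝ))) := by
        refine mul_le_mul_of_nonneg_left (hle.trans ?_) ht1.le
        refine mul_le_mul_of_nonneg_left (sum_le_sum fun i _ => hval i) (by positivity)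
    _ = _ := by
        rw [mul_sum, mul_sum]
        exact sum_congr rfl fun i _ => by ring

/-- Polylogarithms are Abel means of truncated sums. -/
theorem Li_eq_abelMean {x : ℝ} (hx : |x| < 1) {k : Index} (hk : k ≠ []) {t : ℝ}
    (ht : t ∈ Set.Ioo (0 : ℝ) 1) : Li x k t = t ^ x * abelMean (zetaTrunc x k) t := by
  have htabs : |t| < 1 := by rw [abs_of_pos ht.1]; exact ht.2
  rw [Li, dif_neg hk]
  refine tsum_chain_eq (fun m => t ^ ((m (lastIdx hk) : ℝ) + x) * term x k m)
    (fun m => mul_nonneg (Real.rpow_nonneg ht.1.le _) (term_pos hx k m).le) ?_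
  obtain ⟨l, a, rfl⟩ : ∃ v b, k = v ++ [b] :=
    ⟨k.dropLast, k.getLast hk, (List.dropLast_append_getLast hk).symm⟩
  rw [← tendsto_add_atTop_iff_nat 1]
  have hZ : zetaTrunc x (l ++ [a]) = zetaBetween x 0 (l ++ [a]) :=
    funext fun N => zetaTrunc_eq x _ N
  have h1 : zetaBetween x 0 (l ++ [a]) 1 = 0 := by
    rw [zetaBetween_concat, show Ioo 0 1 = ∅ by ext i; simp; omega, sum_empty]
  rw [hZ]
  refine (((hasSum_abelMean (slow_zetaBetween hx (l ++ [a])) h1 htabs).mul_left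
    (t ^ x)).tendsto_sum_nat).congr fun N => ?_
  rw [sum_chains_concat x (fun n => t ^ ((n : ℝ) + x)) l a hk,
    show Ioo 0 (N + 1) = (range N).image (· + 1) by
      ext i
      simp only [mem_Ioo, mem_image, mem_range]
      exact ⟨fun h => ⟨i - 1, by omega, by omega⟩, by rintro ⟨j, h, rfl⟩; omega⟩,
    sum_image (by simp)]
  refine sum_congr rfl fun n _ => ?_
  rw [zetaBetween_concat_succ x (Nat.succ_pos n), Real.rpow_add ht.1, Real.rpow_natCast]
  ring

/-- The transfer of the asymptotics of truncated sums to polylogarithms. -/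
theorem isIntegralReg_of_small {x : ℝ} (hx : |x| < 1) {k : Index} (hk : k ≠ [])
    {ι : Type*} (s : Finset ι) (c : ι → ℝ) (d : ι → ℕ)
    (h : Small fun N => zetaTrunc x k N - ∑ i ∈ s, c i * elem (d i) N) {Q : Polynomial ℝ}
    (hQ : ∀ u : ℝ, Q.eval u = ∑ i ∈ s, c i * (u ^ d i / ((d i).factorial : ℝ))) :
    IsIntegralReg x k Q := by
  set ε : ℕ → ℝ := fun N => zetaTrunc x k N - ∑ i ∈ s, c i * elem (d i) N with hε
  have hslow (i : ι) : Slow fun N => c i * elem (d i) N := (slow_const (c i)).mul (slow_elem _)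
  have hLi {t : ℝ} (ht : t ∈ Set.Ioo (0 : ℝ) 1) :
      Li x k t = t ^ x * (Q.eval (-Real.log (1 - t)) + abelMean ε t) := by
    have htabs : |t| < 1 := by rw [abs_of_pos ht.1]; exact ht.2
    have e1 : zetaTrunc x k = fun N => ∑ i ∈ s, c i * elem (d i) N + ε N := by
      funext N
      simp [hε]
    rw [Li_eq_abelMean hx hk ht, e1, abelMean_add (Slow.sum s fun i _ => hslow i) h.slow htabs,
      abelMean_sum s (fun i _ => hslow i) htabs, hQ]
    simp only [abelMean_const_mul, abelMean_elem _ htabs]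
  -- The prefactor `t^x` is harmless: it differs from `1` by `O(1 - t)`, which absorbs the
  -- logarithmic polynomial.
  have hpow : (fun t : ℝ => t ^ x - 1) =O[𝓝[<] 1] fun t => 1 - t := by
    have h1 := (Real.hasDerivAt_rpow_const (x := 1) (p := x) (Or.inl one_ne_zero)).isBigO_sub
    simp only [Real.one_rpow] at h1
    exact (h1.mono nhdsWithin_le_nhds).trans
      (IsBigO.of_bound 1 (Eventually.of_forall fun t => by rw [one_mul, norm_sub_rev]))
  have hbdd : (fun t : ℝ => t ^ x) =O[𝓝[<] 1] fun _ => (1 : ℝ) := by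
    have : ContinuousAt (fun t : ℝ => t ^ x) 1 :=
      Real.continuousAt_rpow_const _ _ (Or.inl one_ne_zero)
    exact (this.isBigO_one ℝ).mono nhdsWithin_le_nhds
  have hmain : SmallAtOne fun t => Li x k t - Q.eval (-Real.log (1 - t)) := by
    have hpoly : SmallAtOne fun t => (t ^ x - 1) * Q.eval (-Real.log (1 - t)) := by
      simp only [hQ, mul_sum]
      refine SmallAtOne.sum s fun i _ => ⟨d i, hpow.mul ?_⟩
      refine IsBigO.const_mul_left ?_ _
      simp only [div_eq_inv_mul]
      refine IsBigO.const_mul_left (IsBigO.of_bound 1 (Eventually.of_forall fun t => ?_)) _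
      simp
    obtain ⟨p, hp⟩ := hpoly.add (SmallAtOne.bounded_mul hbdd (small_abelMean h))
    refine ⟨p, hp.congr' ?_ EventuallyEq.rfl⟩
    filter_upwards [Ioo_mem_nhdsLT (show (0 : ℝ) < 1 by norm_num)] with t ht
    rw [hLi ht]
    ring
  obtain ⟨p, hp⟩ := hmain
  exact ⟨p + 1, Nat.succ_pos p, SmallAtOne.of_le (Nat.le_succ p) hp⟩

end HurwitzMZV

/-! ### Uniqueness of the regularizations and comparison of generating series -/

namespace HurwitzMZV

open Finset Filter Asymptotics Topology

/-- A polynomial is determined by its values along a filter tending to infinity, up to `o(1)`. -/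
theorem polynomial_eq_of_tendsto {α : Type*} {l : Filter α} [l.NeBot] {u : α → ℝ}
    (hu : Tendsto u l atTop) {Q R : Polynomial ℝ}
    (h : Tendsto (fun a => Q.eval (u a) - R.eval (u a)) l (𝓝 0)) : Q = R := by
  rw [← sub_eq_zero]
  simp only [← Polynomial.eval_sub] at h
  by_cases hdeg : 0 < (Q - R).degree
  · have h1 := ((Q - R).abs_tendsto_atTop hdeg).comp hu
    exact absurd h.abs (not_tendsto_nhds_of_tendsto_atTop h1 _)
  · rw [Polynomial.eq_C_of_degree_le_zero (not_lt.1 hdeg)] at h ⊢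
    simp only [Polynomial.eval_C] at h
    rw [tendsto_nhds_unique tendsto_const_nhds h, map_zero]

theorem tendsto_inv_mul_log_pow (p : ℕ) :
    Tendsto (fun u : ℝ => u⁻¹ * Real.log u ^ p) atTop (𝓝 0) := by
  refine (Real.isLittleO_pow_log_id_atTop (n := p)).tendsto_div_nhds_zero.congr fun u => ?_
  rw [div_eq_inv_mul]
  rfl

theorem isSeriesReg_unique {x : ℝ} {k : Index} {Q R : Polynomial ℝ} (hQ : IsSeriesReg x k Q)
    (hR : IsSeriesReg x k R) : Q = R := by
  obtain ⟨p, _, hp⟩ := hQ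
  obtain ⟨q, _, hq⟩ := hR
  have h (p : ℕ) : Tendsto (fun N : ℕ => (N : ℝ)⁻¹ * Real.log N ^ p) atTop (𝓝 0) :=
    (tendsto_inv_mul_log_pow p).comp tendsto_natCast_atTop_atTop
  have hlog : Tendsto (fun N : ℕ => Real.log N - psi (1 + x)) atTop atTop :=
    tendsto_atTop_add_const_right _ _ (Real.tendsto_log_atTop.comp tendsto_natCast_atTop_atTop)
  refine polynomial_eq_of_tendsto hlog ?_
  have := (hq.trans_tendsto (h q)).sub (hp.trans_tendsto (h p))
  rw [sub_zero] at this
  exact this.congr fun N => by ring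

theorem isIntegralReg_unique {x : ℝ} {k : Index} {Q R : Polynomial ℝ} (hQ : IsIntegralReg x k Q)
    (hR : IsIntegralReg x k R) : Q = R := by
  obtain ⟨p, _, hp⟩ := hQ
  obtain ⟨q, _, hq⟩ := hR
  have h (p : ℕ) : Tendsto (fun t : ℝ => (1 - t) * Real.log (1 - t) ^ p) (𝓝[<] 1) (𝓝 0) := by
    have h1 := ((tendsto_inv_mul_log_pow p).comp
      (tendsto_inv_nhdsGT_zero.comp tendsto_one_sub)).const_mul ((-1) ^ p)
    rw [mul_zero] at h1
    refine h1.congr fun t => ?_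
    simp only [Function.comp_apply, inv_inv, Real.log_inv]
    rw [mul_left_comm, ← mul_pow, neg_one_mul, neg_neg]
  refine polynomial_eq_of_tendsto tendsto_neg_log_one_sub ?_
  have := (hq.trans_tendsto (h q)).sub (hp.trans_tendsto (h p))
  rw [sub_zero] at this
  exact this.congr fun t => by ring

theorem seriesReg_eq {x : ℝ} {k : Index} {Q : Polynomial ℝ} (hQ : IsSeriesReg x k Q) :
    seriesReg x k = Q :=
  isSeriesReg_unique (Classical.epsilon_spec ⟨Q, hQ⟩) hQ

theorem integralReg_eq {x : ℝ} {k : Index} {Q : Polynomial ℝ} (hQ : IsIntegralReg x k Q) :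
    integralReg x k = Q :=
  isIntegralReg_unique (Classical.epsilon_spec ⟨Q, hQ⟩) hQ

theorem Small.isBigO {f : ℕ → ℝ} (hf : Small f) :
    ∃ p : ℕ, 0 < p ∧ f =O[atTop] fun N : ℕ => (N : ℝ)⁻¹ * Real.log N ^ p := by
  obtain ⟨C, p, hC⟩ := hf
  have hlog : Tendsto (fun N : ℕ => Real.log N) atTop atTop :=
    Real.tendsto_log_atTop.comp tendsto_natCast_atTop_atTop
  refine ⟨p + 1, Nat.succ_pos p, IsBigO.of_bound (|C| * 2 ^ (p + 1)) ?_⟩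
  filter_upwards [eventually_gt_atTop 0, hlog.eventually_ge_atTop 1] with N hN h1
  have h2 : 0 ≤ logScale N := zero_le_one.trans (one_le_logScale N)
  have h3 : logScale N ≤ 2 * Real.log N := by
    simp only [logScale]
    linarith
  have h4 : (0 : ℝ) < N := by exact_mod_cast hN
  have h5 : 0 ≤ Real.log N := zero_le_one.trans h1
  rw [Real.norm_eq_abs, Real.norm_of_nonneg (by positivity)]
  calc |f N| ≤ C * logScale N ^ p / N := hC N hN
    _ ≤ |C| * (2 * Real.log N) ^ (p + 1) / N := by
        gcongr
        · exact le_abs_self C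
        · exact (logScale_pow_mono N (Nat.le_succ p)).trans (pow_le_pow_left₀ h2 h3 _)
    _ = _ := by rw [mul_pow]; ring

/-- Specializing `T` to a number reduces identities over `ℝ[T]` to the real power series that occur
in the asymptotics. -/
theorem eval_coeff_incl_mul_expT (A : PowerSeries ℝ) (m : ℕ) (c : ℝ) :
    (PowerSeries.coeff m (incl A * expT)).eval c = PowerSeries.coeff m (A * expSeries c) := by
  have h := PowerSeries.coeff_map (Polynomial.evalRingHom c) m (incl A * expT)
  rw [Polynomial.coe_evalRingHom] at h
  rw [← h, map_mul]
  congr 2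
  · ext n
    simp [incl]
  · ext n
    simp [expT, expSeries, div_eq_inv_mul]

/-- Coefficientwise smallness of a sequence of power series. -/
def SmallSeries (A : ℕ → PowerSeries ℝ) : Prop := ∀ m, Small fun N => PowerSeries.coeff m (A N)

/-- Coefficientwise slow growth of a sequence of power series. -/
def SlowSeries (A : ℕ → PowerSeries ℝ) : Prop := ∀ m, Slow fun N => PowerSeries.coeff m (A N)

theorem SlowSeries.mul_small {A B : ℕ → PowerSeries ℝ} (hA : SlowSeries A) (hB : SmallSeries B) :
    SmallSeries fun N => A N * B N := by
  intro m
  simp only [PowerSeries.coeff_mul]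
  exact Small.sum _ fun p _ => (hA p.1).mul_small (hB p.2)

theorem slowSeries_const (A : PowerSeries ℝ) : SlowSeries fun _ => A := fun _ => slow_const _

theorem SmallSeries.add {A B : ℕ → PowerSeries ℝ} (hA : SmallSeries A) (hB : SmallSeries B) :
    SmallSeries fun N => A N + B N := fun m => by
  simpa only [map_add] using (hA m).add (hB m)

theorem slowSeries_onesSeries {x : ℝ} (hx : |x| < 1) : SlowSeries (onesSeries x) := fun m =>
  (slow_zetaBetween hx (ones m)).congr fun N _ => by
    rw [← mk_ones, PowerSeries.coeff_mk, zetaTrunc_eq]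

theorem onesSeries_zero_eq (N : ℕ) : onesSeries 0 N = PowerSeries.mk fun m => elem m N := by
  rw [← mk_ones]
  simp only [zetaTrunc_eq, elem]

theorem smallSeries_onesSeries_sub {x : ℝ} (hx : |x| < 1) :
    SmallSeries fun N => onesSeries x N - taylor (gammaQuot x) * expSeries (Real.log N) := fun m =>
  (small_coeff_onesSeries_sub hx m).congr fun N _ => by rw [mul_comm (expSeries _)]

theorem taylor_seriesFactor (x : ℝ) :
    taylor (seriesFactor x) = taylor (gammaQuot x) * expSeries (psi (1 + x)) := by
  rw [← taylor_exp, ← taylor_mul (analyticAt_gammaQuot x 0) (analyticAt_exp_mul _ 0)]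
  congr 1
  funext y
  rw [seriesFactor, gammaQuot]
  ring

theorem analyticAt_seriesFactor (x : ℝ) : AnalyticAt ℝ (seriesFactor x) 0 := by
  refine ((analyticAt_gammaQuot x 0).mul (analyticAt_exp_mul (psi (1 + x)) 0)).congr ?_
  refine Eventually.of_forall fun y => ?_
  simp only [Pi.mul_apply, seriesFactor, gammaQuot]
  ring

theorem gammaQuot_zero_inv (y : ℝ) : (gammaQuot 0 y)⁻¹ = Real.Gamma (1 + y) := by
  simp [gammaQuot]

theorem gammaQuot_zero_zero : gammaQuot 0 0 = 1 := by simp [gammaQuot]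

theorem analyticAt_gamma_one_add : AnalyticAt ℝ (fun y => Real.Gamma (1 + y)) 0 := by
  have := (analyticAt_gammaQuot 0 0).inv (by rw [gammaQuot_zero_zero]; exact one_ne_zero)
  exact this.congr (Eventually.of_forall gammaQuot_zero_inv)

theorem integralFactor_eq (x : ℝ) :
    integralFactor x = fun y => gammaQuot x y * Real.Gamma (1 + y) := by
  funext y
  rw [integralFactor, gammaQuot]
  ring

theorem analyticAt_integralFactor (x : ℝ) : AnalyticAt ℝ (integralFactor x) 0 := by
  rw [integralFactor_eq]
  exact (analyticAt_gammaQuot x 0).mul analyticAt_gamma_one_add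

theorem taylor_integralFactor (x : ℝ) :
    taylor (integralFactor x) = taylor (gammaQuot x) * taylor fun y => Real.Gamma (1 + y) := by
  rw [integralFactor_eq]
  exact taylor_mul (analyticAt_gammaQuot x 0) analyticAt_gamma_one_add

/-- Formal invertibility of the `x = 0` factor, which allows the product asymptotics at `x = 0` to
be solved for `N^y`. -/
theorem taylor_gammaQuot_zero_mul :
    taylor (gammaQuot 0) * (taylor fun y => Real.Gamma (1 + y)) = 1 := by
  rw [← taylor_mul (analyticAt_gammaQuot 0 0) analyticAt_gamma_one_add, ← map_one PowerSeries.C,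
    ← taylor_const]
  refine taylor_congr ?_
  have h := (analyticAt_gammaQuot 0 0).continuousAt.eventually_ne
    (by rw [gammaQuot_zero_zero]; exact one_ne_zero)
  filter_upwards [h] with y hy
  rw [← gammaQuot_zero_inv, mul_inv_cancel₀ hy]

/-- The series regularization of a family of indices with known asymptotic generating series. -/
theorem isSeriesReg_of_smallSeries {x : ℝ} {k : ℕ → Index} {A : PowerSeries ℝ}
    (h : SmallSeries fun N => (PowerSeries.mk fun m => zetaTrunc x (k m) N) -
      A * taylor (gammaQuot x) * expSeries (Real.log N)) (m : ℕ) :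
    IsSeriesReg x (k m)
      (PowerSeries.coeff m (incl A * incl (taylor (seriesFactor x)) * expT)) := by
  refine Small.isBigO ((h m).congr fun N _ => ?_)
  rw [map_sub, PowerSeries.coeff_mk, ← map_mul, eval_coeff_incl_mul_expT, taylor_seriesFactor]
  congr 2
  -- The digamma value enters only here, as the constant that recentres the variable of the
  -- polynomial.
  have : expSeries (Real.log N) = expSeries (psi (1 + x)) * expSeries (Real.log N - psi (1 + x)) := by
    rw [← expSeries_add, add_sub_cancel]
  rw [this]
  ring

theorem Li_nil (x t : ℝ) : Li x [] t = 1 := by simp [Li]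

/-- The integral regularization of a family of indices with known asymptotic generating series. -/
theorem isIntegralReg_of_smallSeries {x : ℝ} (hx : |x| < 1) {k : ℕ → Index} {A : PowerSeries ℝ}
    (h : SmallSeries fun N => (PowerSeries.mk fun m => zetaTrunc x (k m) N) -
      A * taylor (gammaQuot x) * expSeries (Real.log N)) {m : ℕ} (hk : k m ≠ []) :
    IsIntegralReg x (k m)
      (PowerSeries.coeff m (incl A * incl (taylor (integralFactor x)) * expT)) := by
  -- At `x = 0` the product behaves like `N^y / Γ(1+y)`. Substituting `Γ(1+y)` times this product
  -- for `N^y` turns `gammaQuot x` into `integralFactor x` and powers of `log N` into the functions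
  -- `elem`.
  have h0 := smallSeries_onesSeries_sub (x := 0) (by simp)
  have h1 : SmallSeries fun N => (PowerSeries.mk fun m => zetaTrunc x (k m) N) -
      A * taylor (integralFactor x) * onesSeries 0 N := by
    have h2 := h.add (SlowSeries.mul_small
      (slowSeries_const (-(A * taylor (integralFactor x)))) h0)
    intro m
    refine (h2 m).congr fun N _ => congrArg _ ?_
    rw [taylor_integralFactor]
    linear_combination A * taylor (gammaQuot x) * expSeries (Real.log N) *
      taylor_gammaQuot_zero_mul
  refine isIntegralReg_of_small hx hk (antidiagonal m)
    (fun p => PowerSeries.coeff p.1 (A * taylor (integralFactor x))) (fun p => p.2)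
    ((h1 m).congr fun N _ => ?_) fun u => ?_
  · rw [map_sub, PowerSeries.coeff_mk, PowerSeries.coeff_mul, onesSeries_zero_eq]
    simp only [PowerSeries.coeff_mk]
  · rw [← map_mul, eval_coeff_incl_mul_expT, PowerSeries.coeff_mul]
    simp only [expSeries, PowerSeries.coeff_mk]

theorem smallSeries_ones {x : ℝ} (hx : |x| < 1) :
    SmallSeries fun N => (PowerSeries.mk fun m => zetaTrunc x (ones m) N) -
      1 * taylor (gammaQuot x) * expSeries (Real.log N) := by
  simp only [mk_ones, one_mul]
  exact smallSeries_onesSeries_sub hx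

theorem smallSeries_plus_ones {x : ℝ} (hx : |x| < 1) {k : Index} (hk : k ≠ []) :
    SmallSeries fun N => (PowerSeries.mk fun m => zetaTrunc x (plus k ++ ones m) N) -
      starSeries x k * taylor (gammaQuot x) * expSeries (Real.log N) := by
  simp only [mk_plus_ones x hk]
  have h1 : SmallSeries fun N => starTrunc x k N - starSeries x k :=
    fun m => small_coeff_starTrunc_sub hx k m
  have h2 := ((slowSeries_onesSeries hx).mul_small h1).add
    ((slowSeries_const (starSeries x k)).mul_small (smallSeries_onesSeries_sub hx))
  intro m
  refine (h2 m).congr fun N _ => congrArg _ ?_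
  ring

theorem plus_append_ne_nil {k : Index} (hk : k ≠ []) (l : Index) : plus k ++ l ≠ [] := by
  obtain ⟨v, a, rfl⟩ : ∃ v a, k = v ++ [a] :=
    ⟨k.dropLast, k.getLast hk, (List.dropLast_append_getLast hk).symm⟩
  simp [plus_concat]

/-- Trailing ones are stripped until an entry at least `2` is met; the two generating series
therefore cover all indices. -/
theorem index_cases (k : Index) :
    ∃ m, k = ones m ∨ ∃ l : Index, l ≠ [] ∧ k = plus l ++ ones m := by
  induction k using List.reverseRecOn with
  | nil => exact ⟨0, Or.inl rfl⟩
  | append_singleton k a ih =>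
    rcases eq_or_ne a 1 with rfl | ha
    · obtain ⟨m, rfl | ⟨l, hl, rfl⟩⟩ := ih
      · exact ⟨m + 1, Or.inl (ones_succ m).symm⟩
      · exact ⟨m + 1, Or.inr ⟨l, hl, by rw [ones_succ, List.append_assoc]⟩⟩
    · obtain ⟨b, rfl⟩ := PNat.exists_eq_succ_of_ne_one ha
      exact ⟨0, Or.inr ⟨k ++ [b], by simp, by simp [plus_concat, ones]⟩⟩

theorem isSeriesReg_ones {x : ℝ} (hx : |x| < 1) (m : ℕ) : IsSeriesReg x (ones m)
    (PowerSeries.coeff m (incl (taylor (seriesFactor x)) * expT)) := by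
  simpa using isSeriesReg_of_smallSeries (smallSeries_ones hx) m

theorem isIntegralReg_ones {x : ℝ} (hx : |x| < 1) (m : ℕ) : IsIntegralReg x (ones m)
    (PowerSeries.coeff m (incl (taylor (integralFactor x)) * expT)) := by
  cases m with
  -- The empty index is separate: `Li` is `1` there by convention, whereas `t^x` times the Abel mean
  -- of `1` would be `t^x`.
  | zero =>
    have h : integralFactor x 0 = 1 := by
      have : 0 < Real.Gamma (1 + x) := Real.Gamma_pos_of_pos (by linarith [(abs_lt.1 hx).1])
      simp [integralFactor, this.ne']
    have hQ (u : ℝ) :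
        (PowerSeries.coeff 0 (incl (taylor (integralFactor x)) * expT)).eval u = 1 := by
      rw [eval_coeff_incl_mul_expT]
      simp [taylor, expSeries, h]
    refine ⟨1, one_pos, ?_⟩
    simp only [hQ, ones, List.replicate_zero, Li_nil, sub_self]
    exact isBigO_zero _ _
  | succ m =>
    simpa using isIntegralReg_of_smallSeries hx (smallSeries_ones hx) (m := m + 1) (by simp [ones])

end HurwitzMZV

/-! ### The main theorem -/

theorem proposition2p3 (x : ℝ) (hx : |x| < 1) :
    -- the polynomials `Z_*^{(x)}(k; T)` and `P^{(x)}(k; T)` are well defined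
    (∀ k : HurwitzMZV.Index,
      (∃! Q : Polynomial ℝ, HurwitzMZV.IsSeriesReg x k Q) ∧
      (∃! Q : Polynomial ℝ, HurwitzMZV.IsIntegralReg x k Q)) ∧
    -- the two factors are analytic in `y` at `0`
    AnalyticAt ℝ (HurwitzMZV.seriesFactor x) 0 ∧
    AnalyticAt ℝ (HurwitzMZV.integralFactor x) 0 ∧
    -- the identities for `Z_*^{(x)}`
    (PowerSeries.mk (fun m => HurwitzMZV.seriesReg x (HurwitzMZV.ones m)) =
      HurwitzMZV.incl (HurwitzMZV.taylor (HurwitzMZV.seriesFactor x)) * HurwitzMZV.expT) ∧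
    (∀ k : HurwitzMZV.Index, k ≠ [] →
      PowerSeries.mk
          (fun m => HurwitzMZV.seriesReg x (HurwitzMZV.plus k ++ HurwitzMZV.ones m)) =
        HurwitzMZV.incl (HurwitzMZV.starSeries x k) *
          HurwitzMZV.incl (HurwitzMZV.taylor (HurwitzMZV.seriesFactor x)) * HurwitzMZV.expT) ∧
    -- the identities for `P^{(x)}`
    (PowerSeries.mk (fun m => HurwitzMZV.integralReg x (HurwitzMZV.ones m)) =
      HurwitzMZV.incl (HurwitzMZV.taylor (HurwitzMZV.integralFactor x)) * HurwitzMZV.expT) ∧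
    (∀ k : HurwitzMZV.Index, k ≠ [] →
      PowerSeries.mk
          (fun m => HurwitzMZV.integralReg x (HurwitzMZV.plus k ++ HurwitzMZV.ones m)) =
        HurwitzMZV.incl (HurwitzMZV.starSeries x k) *
          HurwitzMZV.incl (HurwitzMZV.taylor (HurwitzMZV.integralFactor x)) *
          HurwitzMZV.expT) := by
  have hS (k : HurwitzMZV.Index) (hk : k ≠ []) (m : ℕ) :=
    HurwitzMZV.isSeriesReg_of_smallSeries (HurwitzMZV.smallSeries_plus_ones hx hk) m
  have hP (k : HurwitzMZV.Index) (hk : k ≠ []) (m : ℕ) :=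
    HurwitzMZV.isIntegralReg_of_smallSeries hx (HurwitzMZV.smallSeries_plus_ones hx hk) (m := m)
      (HurwitzMZV.plus_append_ne_nil hk _)
  refine ⟨fun k => ⟨?_, ?_⟩, HurwitzMZV.analyticAt_seriesFactor x,
    HurwitzMZV.analyticAt_integralFactor x, ?_, fun k hk => ?_, ?_, fun k hk => ?_⟩
  · obtain ⟨m, rfl | ⟨l, hl, rfl⟩⟩ := HurwitzMZV.index_cases k
    · exact ⟨_, HurwitzMZV.isSeriesReg_ones hx m, fun Q hQ =>
        HurwitzMZV.isSeriesReg_unique hQ (HurwitzMZV.isSeriesReg_ones hx m)⟩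
    · exact ⟨_, hS l hl m, fun Q hQ => HurwitzMZV.isSeriesReg_unique hQ (hS l hl m)⟩
  · obtain ⟨m, rfl | ⟨l, hl, rfl⟩⟩ := HurwitzMZV.index_cases k
    · exact ⟨_, HurwitzMZV.isIntegralReg_ones hx m, fun Q hQ =>
        HurwitzMZV.isIntegralReg_unique hQ (HurwitzMZV.isIntegralReg_ones hx m)⟩
    · exact ⟨_, hP l hl m, fun Q hQ => HurwitzMZV.isIntegralReg_unique hQ (hP l hl m)⟩
  · ext1 m
    rw [PowerSeries.coeff_mk]
    exact HurwitzMZV.seriesReg_eq (HurwitzMZV.isSeriesReg_ones hx m)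
  · ext1 m
    rw [PowerSeries.coeff_mk]
    exact HurwitzMZV.seriesReg_eq (hS k hk m)
  · ext1 m
    rw [PowerSeries.coeff_mk]
    exact HurwitzMZV.integralReg_eq (HurwitzMZV.isIntegralReg_ones hx m)
  · ext1 m
    rw [PowerSeries.coeff_mk]
    exact HurwitzMZV.integralReg_eq (hP k hk m)
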